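/- **Claim (Merkle trees are collapsing).** Let $\mathcal H=\{H_\lambda\}_{\lambda\in\mathbb N}$ be a hash family: $H_\lambda$ is a distribution over functions $h\colon\{0,1\}^{n(\lambda)}\to\{0,1\}^{n(\lambda)/2}$ described by keys (bit strings), where $n(\lambda)$ is even, and $(h,x)\mapsto h(x)$ is computed (coherently) by circuits of size polynomial in $\lambda$. A quantum adversary is a (non-uniform) family of quantum circuits over the gates Hadamard, $T$, NOT, CNOT, Toffoli, made up of one unitary circuit for each of its two moves; its size is the number of gates and qubits, and it is polynomial-size if this is at most $p(\lambda)$ for a polynomial $p$ and all large $\lambda$. A function of $\lambda$ is negligible if it decreases faster than the inverse of every polynomial. *Collapsing hash family.* In $\mathsf{HExp}_b(\lambda,\mathsf{Adv})$, $b\in\{0,1\}$, the challenger samples $h\leftarrow H_\lambda$ and sends (the key of) $h$; $\mathsf{Adv}$ replies with a classical $y\in\{0,1\}^{n(\lambda)/2}$ and an $n(\lambda)$-qubit register $\mathcal X$; the challenger measures the bit $[h(\mathcal X)=y]$ and aborts if it is $0$; if $b=1$ it measures $\mathcal X$ in the standard basis; it returns $\mathcal X$, and $\mathsf{Adv}$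 outputs a bit, the output of the experiment. $\mathcal H$ is collapsing if for every polynomial-size $\mathsf{Adv}$ the quantity $|\Pr[\mathsf{HExp}_0=1]-\Pr[\mathsf{HExp}_1=1]|$ is negligible in $\lambda$. *Collapsing vector commitment.* A vector commitment over an alphabet $\Sigma$ of bit strings consists of $\mathsf{Gen},\mathsf{Commit},\mathsf{Open},\mathsf{Verify}$. It is complete if honest openings, at any $Q\subseteq[\ell]$, of honest commitments to any $m\in\Sigma^\ell$ (with $m,Q$ chosen arbitrarily given the key) are accepted with probability $1$. In $\mathsf{VCExp}_b(\lambda,\ell,\mathsf{Adv})$ the challenger samples $\mathsf{ck}\leftarrow\mathsf{Gen}(1^\lambda,\Sigma,\ell)$ and sends it; $\mathsf{Adv}$ replies with a classical message $(\mathsf{cm},Q\subseteq[\ell])$, where $Q$ is sent as the list of its elements in binary, and registers $(\mathcal V,\mathcal O)$ holding symbols $v\in\Sigma^Q$ and an opening proof $\mathsf{pf}$; the challenger measures the bit $\mathsf{Verify}(\mathsf{ck},\mathsf{cm},Q,\mathcal V,\mathcal O)$ and aborts if it is $0$; if $b=1$ it measures $(\mathcal V,\mathcal O)$ in the standard basis;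 it returns $(\mathcal V,\mathcal O)$, and $\mathsf{Adv}$ outputs a bit, the output of the experiment. The commitment is collapsing if for every vector length $\ell=\ell(\lambda)$ and every polynomial-size $\mathsf{Adv}$ the quantity $|\Pr[\mathsf{VCExp}_0=1]-\Pr[\mathsf{VCExp}_1=1]|$ is negligible in $\lambda$. *Merkle tree.* $\mathsf{Merkle}[\mathcal H]$ has alphabet $\Sigma=\{0,1\}^{n(\lambda)}$. $\mathsf{Gen}$ samples $h\leftarrow H_\lambda$. To commit to $m\in\Sigma^\ell$, pad $m$ with zero symbols to length $2^d$, $d=\lceil\log_2\ell\rceil$ (and $d=0$ if $\ell=0$), hash each symbol with $h$ to get the leaves, and hash the concatenations of neighbouring nodes with $h$, level by level, up to the root, which is the commitment. The opening proof for $Q$ consists, for each $i\in Q$, of the $d$ siblings of the nodes on the path from leaf $i$ to the root. $\mathsf{Verify}$ recomputes, for each $i\in Q$, the root from $v_i$ and the path of $i$, and accepts if and only if all these equal $\mathsf{cm}$. If $\mathcal H$ is collapsing, then $\mathsf{Merkle}[\mathcal H]$ is a (complete) collapsing vector commitment over the alphabet $\{0,1\}^{n(\lambda)}$. -/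

import Mathlib

namespace MerkleCollapsing

/-! ### Asymptotics -/

/-- Bit strings of length `n`. -/
abbrev Bits (n : ℕ) : Type := Fin n → Bool

/-- `f` is eventually bounded by a polynomial in the security parameter. -/
def PolyBounded (f : ℕ → ℕ) : Prop :=
  ∃ (p : Polynomial ℕ) (l₀ : ℕ), ∀ l, l₀ < l → f l ≤ p.eval l

/-- `f` tends to `0` faster than the inverse of every polynomial. -/
def Negligible (f : ℕ → ℝ) : Prop :=
  Asymptotics.SuperpolynomialDecay Filter.atTop (fun l : ℕ => (l : ℝ)) f

/-! ### Quantum circuits -/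

/-- Vectors (possibly sub-normalized) of the Hilbert space of qubits labelled by `W`: amplitudes in
the standard basis, whose elements are the assignments `W → Bool`. -/
abbrev State (W : Type) : Type := (W → Bool) → ℂ

/-- Gates of the universal set Clifford + T, with NOT and Toffoli as primitive gates. -/
inductive Gate (W : Type) : Type where
  | not (i : W)
  | hadamard (i : W)
  | phaseT (i : W)
  | cnot (c t : W) (h : c ≠ t)
  | toffoli (c₁ c₂ t : W) (h₁₂ : c₁ ≠ c₂) (h₁ : c₁ ≠ t) (h₂ : c₂ ≠ t)

/-- The unitary of a gate. -/
noncomputable def Gate.apply {W : Type} [DecidableEq W] : Gate W → State W → State W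
  | .not i, ψ => fun b => ψ (Function.update b i (!b i))
  | .hadamard i, ψ => fun b =>
      (1 / (Real.sqrt 2 : ℂ)) * (ψ (Function.update b i false) +
        (if b i then -1 else 1) * ψ (Function.update b i true))
  | .phaseT i, ψ => fun b =>
      (if b i then Complex.exp (Complex.I * (Real.pi : ℂ) / 4) else 1) * ψ b
  | .cnot c t _, ψ => fun b => ψ (Function.update b t (xor (b t) (b c)))
  | .toffoli c₁ c₂ t _ _ _, ψ => fun b => ψ (Function.update b t (xor (b t) (b c₁ && b c₂)))

/-- A circuit is the list of its gates, in the order in which they are applied. -/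
abbrev Circuit (W : Type) : Type := List (Gate W)

/-- The unitary of a circuit. -/
noncomputable def Circuit.run {W : Type} [DecidableEq W] (C : Circuit W) (ψ : State W) : State W :=
  C.foldl (fun φ g => g.apply φ) ψ

/-- The standard basis state of an assignment. -/
noncomputable def ket {W : Type} [Fintype W] [DecidableEq W] (b : W → Bool) : State W :=
  Pi.single b 1

open Classical in
/-- The projection onto the span of the standard basis states that satisfy `P`. Measurements are
described by their unnormalized post-measurement states, whose squared norm is the probability of
the outcome. -/
noncomputable def proj {W : Type} (P : (W → Bool) → Prop) (ψ : State W) : State W :=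
  fun b => if P b then ψ b else 0

/-- The squared norm. -/
noncomputable def normSq {W : Type} [Fintype W] [DecidableEq W] (ψ : State W) : ℝ :=
  ∑ b : W → Bool, ‖ψ b‖ ^ 2

/-- The probability that a party holding `ψ` runs `C`, measures the qubit `out`, and obtains `1`. -/
noncomputable def acceptProb {W : Type} [Fintype W] [DecidableEq W]
    (C : Circuit W) (out : W) (ψ : State W) : ℝ :=
  normSq (proj (fun b => b out = true) (C.run ψ))

/-! ### Hash families -/

/-- A family of distributions `H_l` over functions `{0,1}^(inLen l) → {0,1}^(outLen l)`. A function
of the family is described by a key, and `keyDist` is the distribution of the keys. -/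
structure HashFamily where
  inLen : ℕ → ℕ
  outLen : ℕ → ℕ
  keyLen : ℕ → ℕ
  keyDist : (l : ℕ) → PMF (Bits (keyLen l))
  eval : (l : ℕ) → Bits (keyLen l) → Bits (inLen l) → Bits (outLen l)

/-- The registers of a party that deals with a hash function: the key, a hash input, a hash output,
and work qubits. -/
inductive HashWire (keyLen inLen outLen work : ℕ) : Type where
  | key (i : Fin keyLen)
  | inp (i : Fin inLen)
  | out (i : Fin outLen)
  | work (i : Fin work)
  deriving DecidableEq, Fintype

/-- The basis state with the given key, hash input and hash output, and work qubits `0`. -/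
def hashInit {κ n m a : ℕ} (k : Bits κ) (x : Bits n) (y : Bits m) : HashWire κ n m a → Bool
  | .key i => k i
  | .inp i => x i
  | .out i => y i
  | .work _ => false

/-- The functions of the family are evaluated (coherently, given the key) by circuits of polynomial
size: `|k, x, y, 0⟩ ↦ |k, x, y ⊕ h_k(x), 0⟩`. -/
def HashFamily.EfficientlyComputable (H : HashFamily) : Prop :=
  ∃ (work : ℕ → ℕ)
    (C : (l : ℕ) → Circuit (HashWire (H.keyLen l) (H.inLen l) (H.outLen l) (work l))),
    PolyBounded (fun l => (C l).length + H.keyLen l + H.inLen l + H.outLen l + work l) ∧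
    ∀ l k x y, (C l).run (ket (hashInit k x y)) =
      ket (hashInit k x (fun i => xor (y i) (H.eval l k x i)))

/-- An adversary in the collapsing experiment of a hash function: the unitary circuit that it runs
on receiving the key, the one that it runs when it gets the input register back, and the qubit that
holds its final output. -/
structure HashAdversary (keyLen inLen outLen : ℕ) where
  work : ℕ
  first : Circuit (HashWire keyLen inLen outLen work)
  second : Circuit (HashWire keyLen inLen outLen work)
  answer : HashWire keyLen inLen outLen work

/-- The size of an adversary: the number of its gates and qubits. -/
def HashAdversary.size {κ n m : ℕ} (A : HashAdversary κ n m) : ℕ :=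
  A.first.length + A.second.length + κ + n + m + A.work

/-- `Pr[Exp_b = 1]` in the collapsing experiment for hash functions. -/
noncomputable def HashFamily.collapseProb (H : HashFamily) (l : ℕ)
    (A : HashAdversary (H.keyLen l) (H.inLen l) (H.outLen l)) (b : Bool) : ℝ :=
  ∑ k : Bits (H.keyLen l), (H.keyDist l k).toReal *
    ∑ y : Bits (H.outLen l),
      -- the adversary acts, and its output register is measured with outcome `y`
      let φ := proj (fun β => (fun i => β (.out i)) = y)
        (A.first.run (ket (hashInit k (fun _ => false) (fun _ => false))))
      -- the challenger measures whether the input register is mapped to `y`, with outcome "yes"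
      let χ := proj (fun β => H.eval l k (fun i => β (.inp i)) = y) φ
      if b then
        ∑ x : Bits (H.inLen l),
          acceptProb A.second A.answer (proj (fun β => (fun i => β (.inp i)) = x) χ)
      else acceptProb A.second A.answer χ

/-- Collapsing hash families. -/
def HashFamily.Collapsing (H : HashFamily) : Prop :=
  ∀ A : (l : ℕ) → HashAdversary (H.keyLen l) (H.inLen l) (H.outLen l),
    PolyBounded (fun l => (A l).size) →
    Negligible (fun l => |H.collapseProb l (A l) false - H.collapseProb l (A l) true|)

/-! ### Vector commitments -/

/-- A vector commitment scheme, whose alphabet at security parameter `l` is `{0,1}^(symLen l)`.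
Below `l` is the security parameter and `N` the vector length, and positions are numbered from `0`.
Keys, commitments and opening proofs are bit strings; the length of an opening proof may depend on
the set of opened positions. -/
structure VectorCommitment where
  symLen : ℕ → ℕ
  keyLen : (l N : ℕ) → ℕ
  comLen : (l N : ℕ) → ℕ
  proofLen : (l N : ℕ) → Finset (Fin N) → ℕ
  Aux : (l N : ℕ) → Type
  gen : (l N : ℕ) → PMF (Bits (keyLen l N))
  commit : (l N : ℕ) → Bits (keyLen l N) → (Fin N → Bits (symLen l)) →
    PMF (Bits (comLen l N) × Aux l N)
  openAt : (l N : ℕ) → Bits (keyLen l N) → Aux l N → (Q : Finset (Fin N)) → Bits (proofLen l N Q)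
  verify : (l N : ℕ) → Bits (keyLen l N) → Bits (comLen l N) → (Q : Finset (Fin N)) →
    (Q → Bits (symLen l)) → Bits (proofLen l N Q) → Bool

/-- Completeness: honest openings of honest commitments are accepted with probability `1`, for every
(unbounded) choice of the message and of the positions as a function of the key. -/
def VectorCommitment.Complete (VC : VectorCommitment) : Prop :=
  ∀ (l N : ℕ) (Adv : Bits (VC.keyLen l N) → PMF ((Fin N → Bits (VC.symLen l)) × Finset (Fin N))),
    ((VC.gen l N).bind fun ck =>
      (Adv ck).bind fun mQ =>
        (VC.commit l N ck mQ.1).bind fun ca =>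
          PMF.pure (VC.verify l N ck ca.1 mQ.2 (fun i => mQ.1 i)
            (VC.openAt l N ck ca.2 mQ.2))) true = 1

/-- The registers of an adversary against a vector commitment for vectors of length `N` that opens
at most `slots` positions. The set `Q` of positions is sent as the list of its elements: `used j`
tells whether the list has a `j`-th entry, and `pos j` holds this entry in binary. The register
`val j` holds the symbol for the `j`-th entry, and `prf` holds the opening proof. -/
inductive VCWire (keyLen comLen symLen N slots proofCap work : ℕ) : Type where
  | key (i : Fin keyLen)
  | com (i : Fin comLen)
  | used (j : Fin slots)
  | pos (j : Fin slots) (i : Fin (Nat.clog 2 N))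
  | val (j : Fin slots) (i : Fin symLen)
  | prf (i : Fin proofCap)
  | work (i : Fin work)
  deriving DecidableEq, Fintype

/-- An adversary in the collapsing experiment of a vector commitment: the unitary circuit that it
runs on receiving the key, the one that it runs when it gets the registers for the symbols and for
the opening proof back, and the qubit that holds its final output. -/
structure VCAdversary (keyLen comLen symLen N : ℕ) where
  slots : ℕ
  proofCap : ℕ
  work : ℕ
  first : Circuit (VCWire keyLen comLen symLen N slots proofCap work)
  second : Circuit (VCWire keyLen comLen symLen N slots proofCap work)
  answer : VCWire keyLen comLen symLen N slots proofCap work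

/-- The size of an adversary: the number of its gates and qubits. -/
def VCAdversary.size {κ c σ N : ℕ} (A : VCAdversary κ c σ N) : ℕ :=
  A.first.length + A.second.length + κ + c +
    A.slots * (1 + Nat.clog 2 N + σ) + A.proofCap + A.work

section Registers

variable {κ c σ N s t a : ℕ}

/-- The basis state with the given key and all other qubits `0`. -/
def vcInit (ck : Bits κ) : VCWire κ c σ N s t a → Bool
  | .key i => ck i
  | _ => false

/-- The index of `i` in the increasing enumeration of `Q`. -/
def rank (Q : Finset (Fin N)) (i : Q) : Fin Q.card := (Q.orderIsoOfFin rfl).symm i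

/-- The registers `used` and `pos` hold the encoding of `Q`: the increasing list of its elements,
followed by zeros. -/
def HoldsQuery (Q : Finset (Fin N)) (β : VCWire κ c σ N s t a → Bool) : Prop :=
  ∀ j : Fin s,
    β (.used j) = decide (j.val < Q.card) ∧
    ∀ i, β (.pos j i) =
      if h : j.val < Q.card then (Q.orderEmbOfFin rfl ⟨j, h⟩).val.testBit i else false

/-- The content, in `Σ^Q`, of the registers for the symbols. -/
def valPart (Q : Finset (Fin N)) (hQ : Q.card ≤ s) (β : VCWire κ c σ N s t a → Bool) :
    Q → Bits σ :=
  fun i e => β (.val (Fin.castLE hQ (rank Q i)) e)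

/-- The content of the first `p` qubits of the register for the opening proof. -/
def prfPart {p : ℕ} (hp : p ≤ t) (β : VCWire κ c σ N s t a → Bool) : Bits p :=
  fun e => β (.prf (Fin.castLE hp e))

end Registers

/-- `Pr[Exp_b = 1]` in the collapsing experiment for vector commitments. The challenger aborts if the
classical message is not of the form `(cm, Q)` with a set `Q` of positions such that the registers of
the adversary have room for symbols and an opening proof for `Q`. Only the qubits that hold these
are sent, and measured if `b = 1`. -/
noncomputable def VectorCommitment.collapseProb (VC : VectorCommitment) (l N : ℕ)
    (A : VCAdversary (VC.keyLen l N) (VC.comLen l N) (VC.symLen l) N) (b : Bool) : ℝ :=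
  ∑ ck : Bits (VC.keyLen l N), (VC.gen l N ck).toReal *
    ∑ cm : Bits (VC.comLen l N), ∑ Q : Finset (Fin N),
      if h : Q.card ≤ A.slots ∧ VC.proofLen l N Q ≤ A.proofCap then
        -- the adversary acts, and its classical message is measured with outcome `(cm, Q)`
        let φ := proj (fun β => (fun i => β (.com i)) = cm ∧ HoldsQuery Q β)
          (A.first.run (ket (vcInit ck)))
        -- the challenger measures whether the verifier accepts, with outcome "yes"
        let χ := proj
          (fun β => VC.verify l N ck cm Q (valPart Q h.1 β) (prfPart h.2 β) = true) φ
        if b then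
          ∑ v : Q → Bits (VC.symLen l), ∑ pf : Bits (VC.proofLen l N Q),
            acceptProb A.second A.answer
              (proj (fun β => valPart Q h.1 β = v ∧ prfPart h.2 β = pf) χ)
        else acceptProb A.second A.answer χ
      else 0

/-- Collapsing vector commitments. The vector length is an arbitrary function of the security
parameter. -/
def VectorCommitment.Collapsing (VC : VectorCommitment) : Prop :=
  ∀ (N : ℕ → ℕ)
    (A : (l : ℕ) → VCAdversary (VC.keyLen l (N l)) (VC.comLen l (N l)) (VC.symLen l) (N l)),
    PolyBounded (fun l => (A l).size) →
    Negligible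
      (fun l => |VC.collapseProb l (N l) (A l) false - VC.collapseProb l (N l) (A l) true|)

/-! ### Merkle trees -/

section Merkle

variable {n m : ℕ}

/-- The hash of the concatenation of two strings of half the input length. -/
def hashPair (hn : n = m + m) (h : Bits n → Bits m) (x y : Bits m) : Bits m :=
  h (fun i => Fin.append x y (Fin.cast hn i))

/-- The Merkle tree of a vector: `node k i` is the `i`-th node on level `k` above the leaves. The
leaves are the hashes of the symbols, and the vector is padded with zero symbols. -/
def node {N : ℕ} (hn : n = m + m) (h : Bits n → Bits m) (msg : Fin N → Bits n) : ℕ → ℕ → Bits m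
  | 0, i => h (if hi : i < N then msg ⟨i, hi⟩ else fun _ => false)
  | k + 1, i => hashPair hn h (node hn h msg k (2 * i)) (node hn h msg k (2 * i + 1))

/-- The root computed from the symbol `v` at position `i` and an authentication path: `path k` is
the sibling of the node on level `k` of the path from the leaf to the root. -/
def pathRoot (hn : n = m + m) (h : Bits n → Bits m) (i : ℕ) (v : Bits n) :
    (d : ℕ) → (Fin d → Bits m) → Bits m
  | 0, _ => h v
  | d + 1, path =>
      let y := pathRoot hn h i v d (fun k => path k.castSucc)
      if i.testBit d then hashPair hn h (path (Fin.last d)) y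
      else hashPair hn h y (path (Fin.last d))

/-- The nodes of a Merkle tree of height `d`. -/
abbrev Tree (m d : ℕ) : Type := (k : Fin (d + 1)) → Fin (2 ^ (d - k.val)) → Bits m

theorem sibling_lt {N : ℕ} (i : Fin N) (k : Fin (Nat.clog 2 N)) :
    (i.val / 2 ^ k.val) ^^^ 1 < 2 ^ (Nat.clog 2 N - k.val) := by
  have hi : i.val < 2 ^ Nat.clog 2 N := lt_of_lt_of_le i.isLt (Nat.le_pow_clog one_lt_two N)
  apply Nat.xor_lt_two_pow
  · rw [Nat.div_lt_iff_lt_mul (by positivity), ← pow_add, Nat.sub_add_cancel k.isLt.le]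
    exact hi
  · exact Nat.one_lt_two_pow (Nat.sub_ne_zero_of_lt k.isLt)

/-- The authentication path of position `i` in a Merkle tree. -/
def authPath {N : ℕ} (tr : Tree m (Nat.clog 2 N)) (i : Fin N) : Fin (Nat.clog 2 N) → Bits m :=
  fun k => tr k.castSucc ⟨(i.val / 2 ^ k.val) ^^^ 1, sibling_lt i k⟩

end Merkle

/-- The Merkle tree vector commitment. An opening proof for `Q` is the list of the authentication
paths of the elements of `Q`, each of which consists of one string per level below the root. -/
noncomputable def merkle (H : HashFamily) (hn : ∀ l, H.inLen l = H.outLen l + H.outLen l) :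
    VectorCommitment where
  symLen := H.inLen
  keyLen l _ := H.keyLen l
  comLen l _ := H.outLen l
  proofLen l N Q := Q.card * (Nat.clog 2 N * H.outLen l)
  Aux l N := (Fin N → Bits (H.inLen l)) × Tree (H.outLen l) (Nat.clog 2 N)
  gen l _ := H.keyDist l
  commit l N ck msg := PMF.pure
    (node (hn l) (H.eval l ck) msg (Nat.clog 2 N) 0,
      (msg, fun k i => node (hn l) (H.eval l ck) msg k i))
  openAt _ _ _ aux Q := fun e =>
    let je := finProdFinEquiv.symm e
    let kr := finProdFinEquiv.symm je.2
    authPath aux.2 (Q.orderEmbOfFin rfl je.1) kr.1 kr.2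
  verify l N ck cm Q v pf := decide (∀ i : Q,
    pathRoot (hn l) (H.eval l ck) i.val (v i) (Nat.clog 2 N)
      (fun k r => pf (finProdFinEquiv (rank Q i, finProdFinEquiv (k, r)))) = cm)

end MerkleCollapsing

/-!
# Merkle trees over a collapsing hash family are collapsing vector commitments

Completeness holds because the root recomputed from a symbol and its honest authentication path is,
level by level, the node of the tree (`pathRoot_eq_node`).

For the collapsing property, fix the security parameter and a key. The wires `pos` and `used` encode
at most one set `Q`, so that measuring the classical message amounts to measuring these wires and the
commitment. When the verifier accepts, the symbol and the authentication path of a slot can be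
rearranged into a chain of hash inputs, its preimages: the `k`-th one is hashed to the node on level
`k` of the path to the root (`preimage`). Measuring the opening is the same as measuring all the
preimages of all slots, since the preimage on level `k + 1` is the pair of the node on level `k`
and its sibling, while the preimage on level `0` is the symbol (`opening_eq_iff`). They are measured
one at a time, slot by slot and from the root down to the leaf. At each step the hash of the next
preimage is already determined by what has been measured: for the root it is the commitment, and
below the root it is a half of the preimage measured before (`hash_maskedPreimage_eq`). This is
exactly the situation of the collapsing experiment for the hash function, so that two consecutive
hybrids are its two cases for a suitable adversary (`exists_hashAdversary_step`). The adversary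
computes the preimage, its hash, the bits measured so far and the verdict of the verifier
coherently, submits the first two, and keeps the others, which amounts to measuring them. On getting
the preimage back it uncomputes it and proceeds as the given adversary; the verdict is conjoined to
the final answer (`exists_hashAdversary`).

The number of hybrids is `slots * (Nat.clog 2 N + 1)`, which is at most the size of the given
adversary even if the vector length `N` is huge. Adversaries are non-uniform, so that the step with
the largest gap can be used for each security parameter (`exists_hashAdversary_le`), and the gap for
Merkle trees is at most a polynomial times a negligible function (`Negligible.poly_mul_le`).

The size of the reduction is bounded by a small calculus of circuits for Boolean functions:
`HasCircuit f s` allows garbage on the ancillas, so that it is closed under composition with additive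
cost, and at the end the garbage is removed once by `HasCircuit.hasCleanCircuit`. A probability in
which a function of the basis state is measured depends only on the partition that the function
induces on the accepted branches (`measuredProb_congr`), which reduces the comparison of
experiments to statements about basis states.
-/

set_option linter.unusedSectionVars false

namespace MerkleCollapsing

/-! ### Circuits on basis states -/

section Circuits

variable {W W' : Type} [DecidableEq W] [DecidableEq W']

theorem Circuit.run_cons (g : Gate W) (C : Circuit W) (ψ : State W) :
    Circuit.run (g :: C) ψ = Circuit.run C (g.apply ψ) := rfl

theorem Circuit.run_append (C D : Circuit W) (ψ : State W) :
    Circuit.run (C ++ D) ψ = Circuit.run D (Circuit.run C ψ) := by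
  simp [Circuit.run, List.foldl_append]

theorem Gate.apply_add (g : Gate W) (ψ φ : State W) : g.apply (ψ + φ) = g.apply ψ + g.apply φ := by
  cases g <;> funext b <;> simp only [Gate.apply, Pi.add_apply] <;> ring

theorem Gate.apply_smul (g : Gate W) (c : ℂ) (ψ : State W) : g.apply (c • ψ) = c • g.apply ψ := by
  cases g <;> funext b <;> simp only [Gate.apply, Pi.smul_apply, smul_eq_mul] <;> ring

/-- The unitary of a circuit as a linear map. -/
noncomputable def Circuit.runLin (C : Circuit W) : State W →ₗ[ℂ] State W where
  toFun := Circuit.run C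
  map_add' ψ φ := by
    induction C generalizing ψ φ with
    | nil => rfl
    | cons g C ih => simp only [Circuit.run_cons, Gate.apply_add, ih]
  map_smul' c ψ := by
    induction C generalizing ψ with
    | nil => rfl
    | cons g C ih => simp only [Circuit.run_cons, Gate.apply_smul, ih, RingHom.id_apply]

theorem Circuit.run_zero (C : Circuit W) : Circuit.run C 0 = 0 := C.runLin.map_zero

/-- The same gate on renamed wires. -/
def Gate.map (f : W ↪ W') : Gate W → Gate W'
  | .not i => .not (f i)
  | .hadamard i => .hadamard (f i)
  | .phaseT i => .phaseT (f i)
  | .cnot c t h => .cnot (f c) (f t) (f.injective.ne h)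
  | .toffoli a b t h h₁ h₂ =>
    .toffoli (f a) (f b) (f t) (f.injective.ne h) (f.injective.ne h₁) (f.injective.ne h₂)

/-- The same circuit on renamed wires. -/
def Circuit.map (f : W ↪ W') (C : Circuit W) : Circuit W' := List.map (Gate.map f) C

@[simp] theorem Circuit.length_map (f : W ↪ W') (C : Circuit W) :
    (Circuit.map f C).length = C.length := by
  simp [Circuit.map]

/-- The part of a state of the wires `W'` in which the wires outside the range of `f` are
assigned as in `r`. -/
noncomputable def slice (f : W ↪ W') (r : W' → Bool) (ψ : State W') : State W :=
  fun b => ψ (Function.extend f b r)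

theorem update_extend (f : W ↪ W') (b : W → Bool) (r : W' → Bool) (i : W) (v : Bool) :
    Function.update (Function.extend f b r) (f i) v =
      Function.extend f (Function.update b i v) r := by
  funext w
  by_cases hw : ∃ j, f j = w
  · obtain ⟨j, rfl⟩ := hw
    rw [f.injective.extend_apply]
    by_cases hj : j = i
    · subst hj; simp
    · rw [Function.update_of_ne (f.injective.ne hj), f.injective.extend_apply,
        Function.update_of_ne hj]
  · rw [Function.extend_apply' _ _ _ hw, Function.update_of_ne, Function.extend_apply' _ _ _ hw]
    rintro rfl
    exact hw ⟨i, rfl⟩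

theorem Gate.slice_apply_map (f : W ↪ W') (r : W' → Bool) (g : Gate W) (ψ : State W') :
    slice f r ((g.map f).apply ψ) = g.apply (slice f r ψ) := by
  cases g <;> funext b <;>
    simp only [slice, Gate.map, Gate.apply, f.injective.extend_apply, update_extend]

/-- Wires that a circuit does not touch only label the components of the state. -/
theorem Circuit.slice_run_map (f : W ↪ W') (r : W' → Bool) (C : Circuit W) (ψ : State W') :
    slice f r (Circuit.run (Circuit.map f C) ψ) = Circuit.run C (slice f r ψ) := by
  induction C generalizing ψ with
  | nil => rfl
  | cons g C ih =>
    have : Circuit.map f (g :: C) = g.map f :: Circuit.map f C := rfl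
    rw [this, Circuit.run_cons, Circuit.run_cons, ih, Gate.slice_apply_map]

theorem extend_comp_self (f : W ↪ W') (x : W' → Bool) : Function.extend f (x ∘ f) x = x := by
  funext w
  by_cases hw : ∃ j, f j = w
  · obtain ⟨j, rfl⟩ := hw
    rw [f.injective.extend_apply]; rfl
  · rw [Function.extend_apply' _ _ _ hw]

theorem run_map_apply (f : W ↪ W') (C : Circuit W) (ψ : State W') (x : W' → Bool) :
    Circuit.run (Circuit.map f C) ψ x = Circuit.run C (slice f x ψ) (x ∘ f) := by
  rw [← Circuit.slice_run_map]
  simp only [slice, extend_comp_self]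

end Circuits

section Maps

variable {W W' : Type} [Fintype W] [DecidableEq W] [Fintype W'] [DecidableEq W']

theorem ket_apply (b x : W → Bool) [Decidable (x = b)] : ket b x = if x = b then 1 else 0 := by
  simp only [ket, Pi.single_apply]
  congr

/-- The circuit maps the basis state of `b` to the basis state of `b'`. -/
def Maps (C : Circuit W) (b b' : W → Bool) : Prop := Circuit.run C (ket b) = ket b'

theorem Maps.nil (b : W → Bool) : Maps [] b b := rfl

theorem Maps.append {C D : Circuit W} {b b' b'' : W → Bool} (h : Maps C b b')
    (h' : Maps D b' b'') : Maps (C ++ D) b b'' := by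
  unfold Maps at *
  rw [Circuit.run_append, h, h']

theorem Maps.cons {g : Gate W} {D : Circuit W} {b b' b'' : W → Bool} (h : Maps [g] b b')
    (h' : Maps D b' b'') : Maps (g :: D) b b'' := Maps.append h h'

/-- A circuit on a part of the wires changes the contents of these wires only. -/
theorem Maps.map {C : Circuit W} {b b' : W → Bool} (h : Maps C b b') (f : W ↪ W')
    {B B' : W' → Bool} (hB : ∀ w, B (f w) = b w) (hB' : ∀ w, B' (f w) = b' w)
    (hr : ∀ w, (∀ v, f v ≠ w) → B w = B' w) : Maps (Circuit.map f C) B B' := by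
  funext x
  rw [run_map_apply]
  by_cases hx : ∀ w, (∀ v, f v ≠ w) → x w = B w
  · have hs : slice f x (ket B) = ket b := by
      funext c
      rw [slice, ket_apply, ket_apply]
      refine if_congr ⟨fun e => ?_, fun e => ?_⟩ rfl rfl
      · funext v
        rw [← hB, ← e, f.injective.extend_apply]
      · subst e
        funext w
        by_cases hw : ∃ j, f j = w
        · obtain ⟨j, rfl⟩ := hw
          rw [f.injective.extend_apply, hB]
        · rw [Function.extend_apply' _ _ _ hw]
          exact hx w fun v hv => hw ⟨v, hv⟩
    rw [hs, h, ket_apply, ket_apply]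
    refine if_congr ⟨fun e => ?_, fun e => ?_⟩ rfl rfl
    · funext w
      by_cases hw : ∃ j, f j = w
      · obtain ⟨j, rfl⟩ := hw
        rw [hB', ← e]; rfl
      · rw [← hr w fun v hv => hw ⟨v, hv⟩]
        exact hx w fun v hv => hw ⟨v, hv⟩
    · subst e
      funext v
      exact hB' v
  · -- both sides vanish unless the untouched wires are as in `B`
    push Not at hx
    obtain ⟨w, hw, hne⟩ := hx
    have hs : slice f x (ket B) = 0 := by
      funext c
      rw [slice, ket_apply, if_neg]
      · rfl
      · intro e
        refine hne ?_
        rw [← e, Function.extend_apply']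
        rintro ⟨v, hv⟩
        exact hw v hv
    rw [hs, Circuit.run_zero, ket_apply, if_neg]
    · rfl
    · rintro rfl
      exact hne (hr w hw).symm

theorem ket_comp_involutive (b b' : W → Bool) (τ : (W → Bool) → (W → Bool)) (hτ : ∀ x, τ (τ x) = x)
    (hb : τ b = b') : (fun x => ket b (τ x)) = ket b' := by
  funext x
  rw [ket_apply, ket_apply]
  refine if_congr ⟨fun e => ?_, fun e => ?_⟩ rfl rfl
  · rw [← hb, ← e, hτ]
  · rw [e, ← hb, hτ]

theorem maps_not (i : W) (b : W → Bool) : Maps [.not i] b (Function.update b i (!b i)) :=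
  ket_comp_involutive b _ (fun x => Function.update x i (!x i)) (by intro x; simp) rfl

theorem maps_cnot {c t : W} (h : c ≠ t) (b : W → Bool) :
    Maps [.cnot c t h] b (Function.update b t (xor (b t) (b c))) :=
  ket_comp_involutive b _ (fun x => Function.update x t (xor (x t) (x c)))
    (by intro x; simp [Function.update_of_ne h]) rfl

theorem maps_toffoli {a c t : W} (h : a ≠ c) (h₁ : a ≠ t) (h₂ : c ≠ t) (b : W → Bool) :
    Maps [.toffoli a c t h h₁ h₂] b (Function.update b t (xor (b t) (b a && b c))) :=
  ket_comp_involutive b _ (fun x => Function.update x t (xor (x t) (x a && x c)))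
    (by intro x; simp [Function.update_of_ne h₁, Function.update_of_ne h₂]) rfl

/-- The inverse of a gate: `T` has order `8`, and the other gates are involutions. -/
def Gate.inv : Gate W → Circuit W
  | .phaseT i => List.replicate 7 (.phaseT i)
  | g => [g]

/-- The inverse of a circuit. -/
def Circuit.inv (C : Circuit W) : Circuit W := C.reverse.flatMap Gate.inv

theorem Circuit.inv_cons (g : Gate W) (C : Circuit W) :
    Circuit.inv (g :: C) = Circuit.inv C ++ g.inv := by
  simp [Circuit.inv]

theorem Circuit.length_inv_le (C : Circuit W) : (Circuit.inv C).length ≤ 7 * C.length := by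
  induction C with
  | nil => simp [Circuit.inv]
  | cons g C ih =>
    rw [Circuit.inv_cons, List.length_append, List.length_cons]
    have : g.inv.length ≤ 7 := by cases g <;> simp [Gate.inv]
    omega

theorem Gate.run_inv (g : Gate W) (ψ : State W) : Circuit.run g.inv (g.apply ψ) = ψ := by
  cases g with
  | not i => funext b; simp [Gate.inv, Circuit.run, Gate.apply]
  | cnot c t h => funext b; simp [Gate.inv, Circuit.run, Gate.apply, Function.update_of_ne h]
  | toffoli a c t h h₁ h₂ =>
    funext b
    simp [Gate.inv, Circuit.run, Gate.apply, Function.update_of_ne h₁, Function.update_of_ne h₂]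
  | hadamard i =>
    funext b
    have h2 : (Real.sqrt 2 : ℂ) * (Real.sqrt 2 : ℂ) = 2 := by
      rw [← Complex.ofReal_mul, Real.mul_self_sqrt (by norm_num)]; norm_num
    have h0 : (Real.sqrt 2 : ℂ) ≠ 0 := by
      intro h; rw [h] at h2; norm_num at h2
    have h3 : (1 / (Real.sqrt 2 : ℂ)) * (1 / (Real.sqrt 2 : ℂ)) = 1 / 2 := by
      rw [div_mul_div_comm, h2, one_mul]
    simp only [Gate.inv, Circuit.run, List.foldl, Gate.apply, Function.update_idem,
      Function.update_self]
    rcases hb : b i with _ | _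
    · have : Function.update b i false = b := by rw [← hb]; simp
      simp only [this]
      simp only [Bool.false_eq_true, if_false, if_true]
      linear_combination (2 * ψ b) * h3
    · have : Function.update b i true = b := by rw [← hb]; simp
      simp only [this]
      simp only [Bool.false_eq_true, if_false, if_true]
      linear_combination (2 * ψ b) * h3
  | phaseT i =>
    funext b
    simp only [Gate.inv, Circuit.run, List.replicate, List.foldl, Gate.apply]
    split_ifs
    · have : Complex.exp (Complex.I * (Real.pi : ℂ) / 4) ^ 8 = 1 := by
        rw [← Complex.exp_nat_mul, Complex.exp_eq_one_iff]
        exact ⟨1, by push_cast; ring⟩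
      linear_combination (ψ b) * this
    · ring

theorem Circuit.run_inv (C : Circuit W) (ψ : State W) :
    Circuit.run (Circuit.inv C) (Circuit.run C ψ) = ψ := by
  induction C generalizing ψ with
  | nil => rfl
  | cons g C ih => rw [Circuit.inv_cons, Circuit.run_append, Circuit.run_cons, ih, Gate.run_inv]

theorem Maps.inv {C : Circuit W} {b b' : W → Bool} (h : Maps C b b') :
    Maps (Circuit.inv C) b' b := by
  unfold Maps at *
  rw [← h, Circuit.run_inv]

/-- The circuit that adds the bits at `src` to those at `dst`. -/
noncomputable def copyCircuit {O : Type} [Fintype O] (src dst : O → W)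
    (h : ∀ o o', src o ≠ dst o') : Circuit W :=
  Finset.univ.toList.map fun o => .cnot (src o) (dst o) (h o o)

theorem length_copyCircuit {O : Type} [Fintype O] (src dst : O → W)
    (h : ∀ o o', src o ≠ dst o') : (copyCircuit src dst h).length = Fintype.card O := by
  simp [copyCircuit]

theorem maps_copyCircuit {O : Type} [Fintype O] {src dst : O → W}
    (h : ∀ o o', src o ≠ dst o') (hd : Function.Injective dst) {B B' : W → Bool}
    (h₁ : ∀ o, B' (dst o) = xor (B (dst o)) (B (src o)))
    (h₂ : ∀ w, (∀ o, dst o ≠ w) → B w = B' w) : Maps (copyCircuit src dst h) B B' := by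
  classical
  have key : ∀ (L : List O) (B B' : W → Bool), L.Nodup →
      (∀ o ∈ L, B' (dst o) = xor (B (dst o)) (B (src o))) →
      (∀ w, (∀ o ∈ L, dst o ≠ w) → B w = B' w) →
      Maps (L.map fun o => Gate.cnot (src o) (dst o) (h o o)) B B' := by
    intro L
    induction L with
    | nil =>
      intro B B' _ _ h₂
      have : B = B' := funext fun w => h₂ w (by simp)
      subst this
      exact Maps.nil _
    | cons o L ih =>
      intro B B' hn h₁ h₂
      rw [List.nodup_cons] at hn
      rw [List.map_cons]
      refine Maps.cons (maps_cnot _ _) (ih _ _ hn.2 ?_ ?_)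
      · intro o' ho'
        have hne : o' ≠ o := by rintro rfl; exact hn.1 ho'
        rw [Function.update_of_ne (hd.ne hne), Function.update_of_ne (h _ _)]
        exact h₁ o' (List.mem_cons_of_mem _ ho')
      · intro w hw
        by_cases how : dst o = w
        · subst how
          rw [Function.update_self, h₁ o List.mem_cons_self]
        · rw [Function.update_of_ne (Ne.symm how)]
          refine h₂ w fun o' ho' => ?_
          rcases List.mem_cons.1 ho' with rfl | ho'
          · exact how
          · exact hw _ ho'
  exact key _ B B' (Finset.nodup_toList _) (fun o _ => h₁ o)
    (fun w hw => h₂ w fun o => hw o (Finset.mem_toList.2 (Finset.mem_univ _)))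

end Maps

/-! ### Circuit size of Boolean functions -/

section Size

variable {V O P ι : Type} [Fintype V] [DecidableEq V] [Fintype O] [DecidableEq O]
  [Fintype P] [DecidableEq P] [Fintype ι] [DecidableEq ι]

/-- `f` is computed by a circuit that has at most `s` gates and ancillas, and that may leave garbage
on the ancillas: `|b, 0, 0⟩ ↦ |b, f b, g b⟩` for some `g`. Such circuits compose without a blow-up,
in contrast to those that clean up their ancillas. -/
def HasCircuit (f : (V → Bool) → O → Bool) (s : ℕ) : Prop :=
  ∃ (A : Type) (_ : Fintype A) (_ : DecidableEq A) (C : Circuit ((V ⊕ O) ⊕ A))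
    (g : (V → Bool) → A → Bool), C.length + Fintype.card A ≤ s ∧
    ∀ b, Maps C (Sum.elim (Sum.elim b fun _ => false) fun _ => false)
      (Sum.elim (Sum.elim b (f b)) (g b))

/-- `f` is computed by a circuit that has at most `s` gates and ancillas, and that resets the
ancillas: `|b, z, 0⟩ ↦ |b, z ⊕ f b, 0⟩`. -/
def HasCleanCircuit (f : (V → Bool) → O → Bool) (s : ℕ) : Prop :=
  ∃ (A : Type) (_ : Fintype A) (_ : DecidableEq A) (C : Circuit ((V ⊕ O) ⊕ A)),
    C.length + Fintype.card A ≤ s ∧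
    ∀ b z, Maps C (Sum.elim (Sum.elim b z) fun _ => false)
      (Sum.elim (Sum.elim b fun o => xor (z o) (f b o)) fun _ => false)

theorem HasCircuit.mono {f : (V → Bool) → O → Bool} {s s' : ℕ} (h : HasCircuit f s)
    (hs : s ≤ s') : HasCircuit f s' := by
  obtain ⟨A, i, j, C, g, hC, hm⟩ := h
  exact ⟨A, i, j, C, g, hC.trans hs, hm⟩

theorem HasCleanCircuit.hasCircuit {f : (V → Bool) → O → Bool} {s : ℕ}
    (h : HasCleanCircuit f s) : HasCircuit f s := by
  obtain ⟨A, i, j, C, hC, hm⟩ := h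
  refine ⟨A, i, j, C, fun _ _ => false, hC, fun b => ?_⟩
  simpa using hm b fun _ => false

/-- Compute, copy the result, and uncompute. -/
theorem HasCircuit.hasCleanCircuit {f : (V → Bool) → O → Bool} {s : ℕ}
    (h : HasCircuit f s) : HasCleanCircuit f (8 * s + 2 * Fintype.card O) := by
  obtain ⟨A, i, j, C, g, hC, hm⟩ := h
  let e : (V ⊕ O) ⊕ A ↪ (V ⊕ O) ⊕ (A ⊕ O) :=
    ⟨fun w => match w with
      | .inl (.inl v) => .inl (.inl v)
      | .inl (.inr o) => .inr (.inr o)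
      | .inr a => .inr (.inl a), by
      rintro ((v | o) | a) ((v' | o') | a') h <;> simp_all⟩
  let cp : Circuit ((V ⊕ O) ⊕ (A ⊕ O)) :=
    copyCircuit (fun o : O => .inr (.inr o)) (fun o => .inl (.inr o)) (by simp)
  refine ⟨A ⊕ O, inferInstance, inferInstance,
    Circuit.map e C ++ (cp ++ Circuit.map e (Circuit.inv C)), ?_, fun b z => ?_⟩
  · have := Circuit.length_inv_le C
    simp only [cp, List.length_append, Circuit.length_map, length_copyCircuit, Fintype.card_sum]
    omega
  · refine Maps.append (b' := Sum.elim (Sum.elim b z) (Sum.elim (g b) (f b))) ?_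
      (Maps.append (b' := Sum.elim (Sum.elim b fun o => xor (z o) (f b o))
        (Sum.elim (g b) (f b))) ?_ ?_)
    · refine (hm b).map e (by rintro ((v | o) | a) <;> rfl) (by rintro ((v | o) | a) <;> rfl) ?_
      rintro ((v | o) | (a | o)) hw
      · rfl
      · rfl
      · exact absurd rfl (hw (.inr a))
      · exact absurd rfl (hw (.inl (.inr o)))
    · refine maps_copyCircuit _ (fun o o' h => by simpa using h) (fun o => rfl) ?_
      rintro ((v | o) | (a | o)) hw
      · rfl
      · exact absurd rfl (hw o)
      · rfl
      · rfl
    · refine (hm b).inv.map e (by rintro ((v | o) | a) <;> rfl) (by rintro ((v | o) | a) <;> rfl) ?_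
      rintro ((v | o) | (a | o)) hw
      · rfl
      · rfl
      · exact absurd rfl (hw (.inr a))
      · exact absurd rfl (hw (.inl (.inr o)))

theorem HasCircuit.comp {f : (V → Bool) → O → Bool} {k : (O → Bool) → P → Bool} {s s' : ℕ}
    (h : HasCircuit f s) (h' : HasCircuit k s') :
    HasCircuit (fun b => k (f b)) (s + s' + Fintype.card O) := by
  obtain ⟨A, i, j, C, g, hC, hm⟩ := h
  obtain ⟨A', i', j', C', g', hC', hm'⟩ := h'
  let e : (V ⊕ O) ⊕ A ↪ (V ⊕ P) ⊕ (O ⊕ (A ⊕ A')) :=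
    ⟨fun w => match w with
      | .inl (.inl v) => .inl (.inl v)
      | .inl (.inr o) => .inr (.inl o)
      | .inr a => .inr (.inr (.inl a)), by
      rintro ((v | o) | a) ((v' | o') | a') h <;> simp_all⟩
  let e' : (O ⊕ P) ⊕ A' ↪ (V ⊕ P) ⊕ (O ⊕ (A ⊕ A')) :=
    ⟨fun w => match w with
      | .inl (.inl o) => .inr (.inl o)
      | .inl (.inr p) => .inl (.inr p)
      | .inr a => .inr (.inr (.inr a)), by
      rintro ((v | o) | a) ((v' | o') | a') h <;> simp_all⟩
  refine ⟨O ⊕ (A ⊕ A'), inferInstance, inferInstance, Circuit.map e C ++ Circuit.map e' C',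
    fun b => Sum.elim (f b) (Sum.elim (g b) (g' (f b))), ?_, fun b => ?_⟩
  · simp only [List.length_append, Circuit.length_map, Fintype.card_sum]
    omega
  · refine Maps.append (b' := Sum.elim (Sum.elim b fun _ => false)
      (Sum.elim (f b) (Sum.elim (g b) fun _ => false))) ?_ ?_
    · refine (hm b).map e (by rintro ((v | o) | a) <;> rfl) (by rintro ((v | o) | a) <;> rfl) ?_
      rintro ((v | p) | (o | (a | a))) hw
      · rfl
      · rfl
      · exact absurd rfl (hw (.inl (.inr o)))
      · exact absurd rfl (hw (.inr a))
      · rfl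
    · refine (hm' (f b)).map e' (by rintro ((v | o) | a) <;> rfl)
        (by rintro ((v | o) | a) <;> rfl) ?_
      rintro ((v | p) | (o | (a | a))) hw
      · rfl
      · exact absurd rfl (hw (.inl (.inr p)))
      · rfl
      · rfl
      · exact absurd rfl (hw (.inr a))

theorem HasCircuit.pair {f : (V → Bool) → O → Bool} {k : (V → Bool) → P → Bool} {s s' : ℕ}
    (h : HasCircuit f s) (h' : HasCircuit k s') :
    HasCircuit (fun b => Sum.elim (f b) (k b)) (s + s') := by
  obtain ⟨A, i, j, C, g, hC, hm⟩ := h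
  obtain ⟨A', i', j', C', g', hC', hm'⟩ := h'
  let e : (V ⊕ O) ⊕ A ↪ (V ⊕ (O ⊕ P)) ⊕ (A ⊕ A') :=
    ⟨fun w => match w with
      | .inl (.inl v) => .inl (.inl v)
      | .inl (.inr o) => .inl (.inr (.inl o))
      | .inr a => .inr (.inl a), by
      rintro ((v | o) | a) ((v' | o') | a') h <;> simp_all⟩
  let e' : (V ⊕ P) ⊕ A' ↪ (V ⊕ (O ⊕ P)) ⊕ (A ⊕ A') :=
    ⟨fun w => match w with
      | .inl (.inl v) => .inl (.inl v)
      | .inl (.inr p) => .inl (.inr (.inr p))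
      | .inr a => .inr (.inr a), by
      rintro ((v | o) | a) ((v' | o') | a') h <;> simp_all⟩
  refine ⟨A ⊕ A', inferInstance, inferInstance, Circuit.map e C ++ Circuit.map e' C',
    fun b => Sum.elim (g b) (g' b), ?_, fun b => ?_⟩
  · simp only [List.length_append, Circuit.length_map, Fintype.card_sum]
    omega
  · refine Maps.append (b' := Sum.elim (Sum.elim b (Sum.elim (f b) fun _ => false))
      (Sum.elim (g b) fun _ => false)) ?_ ?_
    · refine (hm b).map e (by rintro ((v | o) | a) <;> rfl) (by rintro ((v | o) | a) <;> rfl) ?_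
      rintro ((v | (o | p)) | (a | a)) hw
      · rfl
      · exact absurd rfl (hw (.inl (.inr o)))
      · rfl
      · exact absurd rfl (hw (.inr a))
      · rfl
    · refine (hm' b).map e' (by rintro ((v | o) | a) <;> rfl)
        (by rintro ((v | o) | a) <;> rfl) ?_
      rintro ((v | (o | p)) | (a | a)) hw
      · rfl
      · rfl
      · exact absurd rfl (hw (.inl (.inr p)))
      · rfl
      · exact absurd rfl (hw (.inr a))

theorem hasCircuit_proj (r : O → V) :
    HasCircuit (fun (b : V → Bool) o => b (r o)) (Fintype.card O) := by
  refine ⟨Empty, inferInstance, inferInstance,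
    copyCircuit (fun o => .inl (.inl (r o))) (fun o => .inl (.inr o)) (by simp),
    fun _ => Empty.elim, ?_, fun b => ?_⟩
  · simp [length_copyCircuit]
  · refine maps_copyCircuit _ (fun o o' h => by simpa using h) (fun o => by simp) ?_
    rintro ((v | o) | a) hw
    · rfl
    · exact absurd rfl (hw o)
    · exact a.elim

theorem HasCircuit.reindex {f : (V → Bool) → O → Bool} {s : ℕ} (h : HasCircuit f s)
    (r : P → O) : HasCircuit (fun b p => f b (r p)) (s + Fintype.card P + Fintype.card O) :=
  h.comp (hasCircuit_proj r)

theorem hasCircuit_family {f : ι → (V → Bool) → O → Bool} {s : ℕ}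
    (h : ∀ i, HasCircuit (f i) s) :
    HasCircuit (fun b (p : ι × O) => f p.1 b p.2) (Fintype.card ι * s) := by
  choose A hF hD C g hs hm using h
  let e : (i : ι) → (V ⊕ O) ⊕ A i ↪ (V ⊕ (ι × O)) ⊕ (Σ i, A i) := fun i =>
    ⟨fun w => match w with
      | .inl (.inl v) => .inl (.inl v)
      | .inl (.inr o) => .inl (.inr (i, o))
      | .inr a => .inr ⟨i, a⟩, by
      rintro ((v | o) | a) ((v' | o') | a') h <;> simp_all⟩
  -- `st b S` is the assignment after the circuits with index in `S` have been run
  let st : (V → Bool) → Finset ι → (V ⊕ (ι × O)) ⊕ (Σ i, A i) → Bool := fun b S =>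
    Sum.elim (Sum.elim b fun p => if p.1 ∈ S then f p.1 b p.2 else false)
      fun a => if a.1 ∈ S then g a.1 b a.2 else false
  have step : ∀ b S i, i ∉ S → Maps (Circuit.map (e i) (C i)) (st b S) (st b (insert i S)) := by
    intro b S i hi
    refine (hm i b).map (e i) ?_ ?_ ?_
    · rintro ((v | o) | a)
      · rfl
      · exact if_neg hi
      · exact if_neg hi
    · rintro ((v | o) | a)
      · rfl
      · exact if_pos (Finset.mem_insert_self _ _)
      · exact if_pos (Finset.mem_insert_self _ _)
    · rintro ((v | ⟨i', o⟩) | ⟨i', a⟩) hw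
      · rfl
      · have : i' ≠ i := by rintro rfl; exact hw (.inl (.inr o)) rfl
        simp [st, this]
      · have : i' ≠ i := by rintro rfl; exact hw (.inr a) rfl
        simp [st, this]
  have steps : ∀ b (L : List ι) S, L.Nodup → (∀ i ∈ L, i ∉ S) →
      Maps (L.flatMap fun i => Circuit.map (e i) (C i)) (st b S) (st b (L.toFinset ∪ S)) := by
    intro b L
    induction L with
    | nil => intro S _ _; simpa using Maps.nil _
    | cons i L ih =>
      intro S hn hS
      rw [List.nodup_cons] at hn
      rw [List.flatMap_cons]
      refine Maps.append (step b S i (hS i List.mem_cons_self)) ?_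
      have := ih (insert i S) hn.2 fun i' hi' => by
        rw [Finset.mem_insert, not_or]
        exact ⟨by rintro rfl; exact hn.1 hi', hS i' (List.mem_cons_of_mem _ hi')⟩
      rwa [Finset.union_insert, ← Finset.insert_union, ← List.toFinset_cons] at this
  refine ⟨Σ i, A i, inferInstance, inferInstance,
    Finset.univ.toList.flatMap fun i => Circuit.map (e i) (C i), fun b a => g a.1 b a.2, ?_,
    fun b => ?_⟩
  · rw [List.length_flatMap, Fintype.card_sigma]
    simp only [Circuit.length_map]
    rw [Finset.sum_map_toList, ← Finset.sum_add_distrib, ← smul_eq_mul]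
    exact Finset.sum_le_card_nsmul _ _ _ fun i _ => hs i
  · have := steps b Finset.univ.toList ∅ (Finset.nodup_toList _) (by simp)
    simpa [st] using this

/-- The case of a single output bit of `HasCircuit`. -/
abbrev HasBitCircuit (f : (V → Bool) → Bool) (s : ℕ) : Prop :=
  HasCircuit (fun b (_ : Unit) => f b) s

theorem hasCircuit_pi {f : (V → Bool) → ι → Bool} {s : ℕ}
    (h : ∀ i, HasBitCircuit (fun b => f b i) s) : HasCircuit f (Fintype.card ι * (s + 2)) := by
  refine ((hasCircuit_family (fun i => h i)).reindex fun i => (i, ())).mono ?_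
  simp only [Fintype.card_prod, Fintype.card_unit]
  exact le_of_eq (by ring)

theorem hasBitCircuit_var (v : V) : HasBitCircuit (fun b => b v) 1 := hasCircuit_proj _

theorem hasBitCircuit_const (c : Bool) : HasBitCircuit (fun _ : V → Bool => c) 1 := by
  refine ⟨Empty, inferInstance, inferInstance, if c then [.not (.inl (.inr ()))] else [],
    fun _ => Empty.elim, ?_, fun b => ?_⟩
  · cases c <;> simp
  · cases c
    · have : (fun _ : Empty => false) = Empty.elim := funext fun a => a.elim
      rw [← this]
      exact Maps.nil _
    · have := maps_not (.inl (.inr ()) : (V ⊕ Unit) ⊕ Empty)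
        (Sum.elim (Sum.elim b fun _ => false) fun _ => false)
      convert this using 1
      · rfl
      · funext w
        rcases w with (v | o) | a
        · simp
        · simp
        · exact a.elim

/-- The algebraic normal form of a binary operation gives a circuit. -/
theorem hasBitCircuit_op (op : Bool → Bool → Bool) :
    HasBitCircuit (fun b : Unit ⊕ Unit → Bool => op (b (.inl ())) (b (.inr ()))) 4 := by
  let x : ((Unit ⊕ Unit) ⊕ Unit) ⊕ Empty := .inl (.inl (.inl ()))
  let y : ((Unit ⊕ Unit) ⊕ Unit) ⊕ Empty := .inl (.inl (.inr ()))
  let z : ((Unit ⊕ Unit) ⊕ Unit) ⊕ Empty := .inl (.inr ())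
  have hxy : x ≠ y := by simp [x, y]
  have hxz : x ≠ z := by simp [x, z]
  have hyz : y ≠ z := by simp [y, z]
  refine ⟨Empty, inferInstance, inferInstance,
    (if op false false then [.not z] else []) ++
      ((if xor (op false false) (op true false) then [.cnot x z hxz] else []) ++
      ((if xor (op false false) (op false true) then [.cnot y z hyz] else []) ++
      (if xor (xor (op false false) (op false true)) (xor (op true false) (op true true)) then
        [.toffoli x y z hxy hxz hyz] else []))),
    fun _ => Empty.elim, ?_, fun b => ?_⟩
  · simp only [List.length_append]
    split_ifs <;> simp
  · let st : Bool → ((Unit ⊕ Unit) ⊕ Unit) ⊕ Empty → Bool := fun t =>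
      Sum.elim (Sum.elim b fun _ => t) fun _ => false
    have hst : ∀ t t', Function.update (st t) z t' = st t' := by
      intro t t'
      funext w
      rcases w with ((⟨⟩ | ⟨⟩) | ⟨⟩) | a
      · rfl
      · rfl
      · rfl
      · exact a.elim
    have opt : ∀ (c v t : Bool) (g : Gate (((Unit ⊕ Unit) ⊕ Unit) ⊕ Empty)),
        Maps [g] (st t) (Function.update (st t) z (xor t v)) →
        Maps (if c then [g] else []) (st t) (st (xor t (c && v))) := by
      intro c v t g h
      rw [hst] at h
      cases c
      · simpa using Maps.nil (st t)
      · simpa using h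
    have hE : (fun _ : Empty => false) = Empty.elim := funext fun a => a.elim
    have := (opt (op false false) true false _ (maps_not z (st false))).append
      ((opt (xor (op false false) (op true false)) _ _ _ (maps_cnot hxz _)).append
      ((opt (xor (op false false) (op false true)) _ _ _ (maps_cnot hyz _)).append
      (opt (xor (xor (op false false) (op false true)) (xor (op true false) (op true true))) _ _ _
        (maps_toffoli hxy hxz hyz _))))
    rw [← hE]
    convert this using 1
    change st _ = st _
    congr 1
    change op (b (.inl ())) (b (.inr ())) = xor (xor (xor (xor false (op false false && true))
      (xor (op false false) (op true false) && b (.inl ())))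
      (xor (op false false) (op false true) && b (.inr ())))
      (xor (xor (op false false) (op false true)) (xor (op true false) (op true true)) &&
        (b (.inl ()) && b (.inr ())))
    generalize b (.inl ()) = u
    generalize b (.inr ()) = v
    cases u <;> cases v <;> cases op false false <;> cases op false true <;>
      cases op true false <;> cases op true true <;> rfl

theorem HasCircuit.op (op : Bool → Bool → Bool) {f k : (V → Bool) → Bool} {s s' : ℕ}
    (h : HasBitCircuit f s) (h' : HasBitCircuit k s') :
    HasBitCircuit (fun b => op (f b) (k b)) (s + s' + 6) :=
  (h.pair h').comp (hasBitCircuit_op op)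

theorem HasCircuit.not {f : (V → Bool) → Bool} {s : ℕ} (h : HasBitCircuit f s) :
    HasBitCircuit (fun b => !f b) (s + 7) :=
  (HasCircuit.op (fun x _ => !x) h (hasBitCircuit_const false)).mono (by omega)

theorem hasBitCircuit_forall {k : ℕ} {f : Fin k → (V → Bool) → Bool} {s : ℕ}
    (h : ∀ i, HasBitCircuit (f i) s) :
    HasBitCircuit (fun b => decide (∀ i, f i b = true)) (k * (s + 6) + 1) := by
  induction k with
  | zero =>
    convert hasBitCircuit_const (V := V) true using 1
    · simp
    · simp
  | succ k ih =>
    convert HasCircuit.op (fun x y => x && y) (h 0) (ih fun i => h i.succ) using 1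
    · funext b
      rw [Bool.eq_iff_iff]
      simp [Fin.forall_fin_succ]
    · ring

end Size

/-! ### Partial measurements -/

section Measure

variable {V : Type} [Fintype V] [DecidableEq V]

theorem proj_proj (P Q : (V → Bool) → Prop) (ψ : State V) :
    proj P (proj Q ψ) = proj (fun b => Q b ∧ P b) ψ := by
  funext b
  by_cases hP : P b <;> by_cases hQ : Q b <;> simp [proj, hP, hQ]

theorem proj_congr {P Q : (V → Bool) → Prop} (h : ∀ b, P b ↔ Q b) (ψ : State V) :
    proj P ψ = proj Q ψ := by
  rw [show P = Q from funext fun b => propext (h b)]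

theorem proj_eq_zero {P : (V → Bool) → Prop} (h : ∀ b, ¬ P b) (ψ : State V) : proj P ψ = 0 := by
  funext b
  simp [proj, h]

theorem normSq_zero : normSq (0 : State V) = 0 := by simp [normSq]

theorem acceptProb_zero (C : Circuit V) (o : V) : acceptProb C o 0 = 0 := by
  have : proj (fun b : V → Bool => b o = true) 0 = 0 := by funext b; simp [proj]
  rw [acceptProb, Circuit.run_zero, this, normSq_zero]

theorem acceptProb_append (C D : Circuit V) (o : V) (ψ : State V) :
    acceptProb (C ++ D) o ψ = acceptProb D o (C.run ψ) := by
  rw [acceptProb, acceptProb, Circuit.run_append]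

/-- The probability of the answer `1` of a party that runs `C` on the state that remains after the
event `P` has been measured with outcome "yes", and then the function `R` of the standard basis. -/
noncomputable def measuredProb {α : Type} [Fintype α] (C : Circuit V) (o : V)
    (P : (V → Bool) → Prop) (R : (V → Bool) → α) (ψ : State V) : ℝ :=
  ∑ r, acceptProb C o (proj (fun b => P b ∧ R b = r) ψ)

theorem measuredProb_of_determined {α : Type} [Fintype α] (C : Circuit V) (o : V)
    {P : (V → Bool) → Prop} {R : (V → Bool) → α} (ψ : State V)
    (h : ∀ b b', P b → P b' → R b = R b') :
    measuredProb C o P R ψ = acceptProb C o (proj P ψ) := by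
  by_cases hP : ∃ b, P b
  · obtain ⟨b, hb⟩ := hP
    rw [measuredProb, Finset.sum_eq_single (R b)]
    · rw [proj_congr fun b' => and_iff_left_of_imp fun hb' => h b' b hb' hb]
    · intro r _ hr
      rw [proj_eq_zero, acceptProb_zero]
      rintro b' ⟨hb', rfl⟩
      exact hr (h b' b hb' hb)
    · simp
  · push Not at hP
    rw [proj_eq_zero hP, acceptProb_zero, measuredProb]
    refine Finset.sum_eq_zero fun r _ => ?_
    rw [proj_eq_zero, acceptProb_zero]
    exact fun b hb => hP b hb.1

theorem measuredProb_prod {α β : Type} [Fintype α] [Fintype β] (C : Circuit V) (o : V)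
    (P : (V → Bool) → Prop) (R : (V → Bool) → α) (R' : (V → Bool) → β) (ψ : State V) :
    measuredProb C o P (fun b => (R b, R' b)) ψ =
      ∑ r, measuredProb C o (fun b => P b ∧ R b = r) R' ψ := by
  rw [measuredProb, Fintype.sum_prod_type]
  refine Finset.sum_congr rfl fun r _ => Finset.sum_congr rfl fun r' _ => ?_
  rw [proj_congr fun b => ?_]
  rw [Prod.mk.injEq, and_assoc]

theorem measuredProb_prod_of_determined {α β : Type} [Fintype α] [Fintype β] (C : Circuit V)
    (o : V) {P : (V → Bool) → Prop} {R : (V → Bool) → α} {R' : (V → Bool) → β} (ψ : State V)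
    (h : ∀ b b', P b → P b' → R b = R b' → R' b = R' b') :
    measuredProb C o P (fun b => (R b, R' b)) ψ = measuredProb C o P R ψ := by
  rw [measuredProb_prod]
  refine Finset.sum_congr rfl fun r _ => measuredProb_of_determined C o ψ ?_
  rintro b b' ⟨hb, rfl⟩ ⟨hb', h'⟩
  exact h b b' hb hb' h'.symm

theorem measuredProb_congr_pred {α : Type} [Fintype α] (C : Circuit V) (o : V)
    {P P' : (V → Bool) → Prop} (R : (V → Bool) → α) (ψ : State V) (h : ∀ b, P b ↔ P' b) :
    measuredProb C o P R ψ = measuredProb C o P' R ψ := by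
  rw [show P = P' from funext fun b => propext (h b)]

/-- Measuring a function only depends on the partition that it induces. -/
theorem measuredProb_congr {α β : Type} [Fintype α] [Fintype β] (C : Circuit V) (o : V)
    {P : (V → Bool) → Prop} {R : (V → Bool) → α} {R' : (V → Bool) → β} (ψ : State V)
    (h : ∀ b b', P b → P b' → (R b = R b' ↔ R' b = R' b')) :
    measuredProb C o P R ψ = measuredProb C o P R' ψ := by
  rw [← measuredProb_prod_of_determined C o ψ fun b b' hb hb' => (h b b' hb hb').1,
    ← measuredProb_prod_of_determined (R := R') (R' := R) C o ψ
      fun b b' hb hb' => (h b b' hb hb').2]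
  rw [measuredProb, measuredProb, Fintype.sum_prod_type, Fintype.sum_prod_type_right]
  refine Finset.sum_congr rfl fun r _ => Finset.sum_congr rfl fun r' _ => ?_
  rw [proj_congr fun b => ?_]
  rw [Prod.mk.injEq, Prod.mk.injEq, and_comm (a := R b = _)]

end Measure

/-! ### Adjoining wires -/

section Attach

variable {V U : Type} [Fintype V] [DecidableEq V] [Fintype U] [DecidableEq U]

open Classical in
/-- The state `∑ b, ψ b • |b, G b⟩`, where the wires `U` have been adjoined. -/
noncomputable def attach (G : (V → Bool) → U → Bool) (ψ : State V) : State (V ⊕ U) :=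
  fun x => if x ∘ Sum.inr = G (x ∘ Sum.inl) then ψ (x ∘ Sum.inl) else 0

theorem eq_sumElim_iff {x : V ⊕ U → Bool} {b : V → Bool} {u : U → Bool} :
    x = Sum.elim b u ↔ x ∘ Sum.inl = b ∧ x ∘ Sum.inr = u := by
  constructor
  · rintro rfl
    exact ⟨rfl, rfl⟩
  · rintro ⟨rfl, rfl⟩
    exact (Sum.elim_comp_inl_inr x).symm

theorem attach_eq_sum (G : (V → Bool) → U → Bool) (ψ : State V) :
    attach G ψ = ∑ b, ψ b • ket (Sum.elim b (G b)) := by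
  classical
  funext x
  rw [Finset.sum_apply, Finset.sum_eq_single (x ∘ Sum.inl)]
  · rw [Pi.smul_apply, ket_apply, attach]
    by_cases h : x ∘ Sum.inr = G (x ∘ Sum.inl)
    · rw [if_pos h, if_pos (eq_sumElim_iff.2 ⟨rfl, h⟩)]; simp
    · rw [if_neg h, if_neg fun h' => h (eq_sumElim_iff.1 h').2]; simp
  · intro b _ hb
    rw [Pi.smul_apply, ket_apply, if_neg fun h' => hb (eq_sumElim_iff.1 h').1.symm, smul_zero]
  · simp

/-- What a circuit does to the adjoined wires on basis states, it does on superpositions. -/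
theorem run_attach {C : Circuit (V ⊕ U)} {G G' : (V → Bool) → U → Bool}
    (h : ∀ b, Maps C (Sum.elim b (G b)) (Sum.elim b (G' b))) (ψ : State V) :
    C.run (attach G ψ) = attach G' ψ := by
  rw [attach_eq_sum, attach_eq_sum]
  change C.runLin _ = _
  rw [map_sum]
  refine Finset.sum_congr rfl fun b _ => ?_
  rw [map_smul]
  exact congrArg _ (h b)

theorem proj_attach (P : (V ⊕ U → Bool) → Prop) (G : (V → Bool) → U → Bool) (ψ : State V) :
    proj P (attach G ψ) = attach G (proj (fun b => P (Sum.elim b (G b))) ψ) := by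
  funext x
  by_cases h : x ∘ Sum.inr = G (x ∘ Sum.inl)
  · have : x = Sum.elim (x ∘ Sum.inl) (G (x ∘ Sum.inl)) := eq_sumElim_iff.2 ⟨rfl, h⟩
    simp only [proj, attach, if_pos h]
    have hP : P x ↔ P (Sum.elim (x ∘ Sum.inl) (G (x ∘ Sum.inl))) := by rw [← this]
    by_cases h' : P x
    · rw [if_pos h', if_pos (hP.1 h')]
    · rw [if_neg h', if_neg (mt hP.2 h')]
  · simp [proj, attach, if_neg h]

theorem slice_attach (r : V ⊕ U → Bool) (G : (V → Bool) → U → Bool) (ψ : State V) :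
    slice Function.Embedding.inl r (attach G ψ) = proj (fun b => G b = r ∘ Sum.inr) ψ := by
  funext b
  have h₁ : Function.extend (Function.Embedding.inl : V ↪ V ⊕ U) b r ∘ Sum.inl = b := by
    funext v
    exact (Function.Embedding.inl : V ↪ V ⊕ U).injective.extend_apply _ _ v
  have h₂ : Function.extend (Function.Embedding.inl : V ↪ V ⊕ U) b r ∘ Sum.inr = r ∘ Sum.inr := by
    funext u
    exact Function.extend_apply' _ _ _ (by simp)
  by_cases h : G b = r ∘ Sum.inr
  · simp [slice, attach, h₁, h₂, proj, h]
  · simp [slice, attach, h₁, h₂, proj, h, Ne.symm h]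

theorem run_inl_attach_apply (C : Circuit V) (G : (V → Bool) → U → Bool) (ψ : State V)
    (x : V ⊕ U → Bool) :
    Circuit.run (Circuit.map .inl C) (attach G ψ) x =
      C.run (proj (fun b => G b = x ∘ Sum.inr) ψ) (x ∘ Sum.inl) := by
  rw [run_map_apply, slice_attach]
  rfl

theorem run_inl_attach_const (C : Circuit V) (u : U → Bool) (ψ : State V) :
    Circuit.run (Circuit.map .inl C) (attach (fun _ => u) ψ) = attach (fun _ => u) (C.run ψ) := by
  funext x
  rw [run_inl_attach_apply, attach]
  by_cases h : x ∘ Sum.inr = u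
  · rw [if_pos h]
    congr 2
    funext b
    simp [proj, h]
  · rw [if_neg h, proj_eq_zero (fun b hb => h hb.symm), Circuit.run_zero]
    rfl

theorem ket_sumElim (b : V → Bool) (u : U → Bool) :
    ket (Sum.elim b u) = attach (fun _ => u) (ket b) := by
  classical
  funext x
  rw [ket_apply, attach, ket_apply, ← ite_and]
  exact if_congr (eq_sumElim_iff.trans and_comm) rfl rfl

/-- The conjunction of the answer of a party that acts on the wires `V` and of the adjoined wire
`flag`. The adjoined wires are untouched by the party, so that they act like measured ones. -/
theorem acceptProb_toffoli_attach (C : Circuit V) (ans : V) {flag out : U} (hne : flag ≠ out)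
    {G : (V → Bool) → U → Bool} (hG : ∀ b, G b out = false) (ψ : State V) :
    acceptProb (Circuit.map .inl C ++ [.toffoli (.inl ans) (.inr flag) (.inr out) (by simp)
      (by simp) (by simpa using hne)]) (.inr out) (attach G ψ) =
      measuredProb C ans (fun b => G b flag = true) G ψ := by
  classical
  set φ := Circuit.run (Circuit.map .inl C) (attach G ψ) with hφ
  -- the Toffoli gate permutes the basis states by `τ`
  let τ : (V ⊕ U → Bool) → (V ⊕ U → Bool) := fun x =>
    Function.update x (.inr out) (xor (x (.inr out)) (x (.inl ans) && x (.inr flag)))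
  have hflag : (Sum.inr flag : V ⊕ U) ≠ .inr out := by simpa using hne
  have hτ : Function.Involutive τ := by
    intro x
    simp [τ, Function.update_of_ne hflag]
  rw [acceptProb, Circuit.run_append, ← hφ]
  have h1 : normSq (proj (fun x => x (.inr out) = true)
      (Circuit.run [.toffoli (.inl ans) (.inr flag) (.inr out) (by simp)
        (by simp) (by simpa using hne)] φ)) =
      ∑ x : V ⊕ U → Bool, ‖if τ x (.inr out) = true then φ x else 0‖ ^ 2 := by
    rw [normSq, ← Equiv.sum_comp (Equiv.ofBijective τ hτ.bijective)]
    refine Finset.sum_congr rfl fun x _ => ?_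
    have h2 : Circuit.run [.toffoli (.inl ans) (.inr flag) (.inr out) (by simp) (by simp)
        (by simpa using hne)] φ (τ x) = φ x := congrArg φ (hτ x)
    rw [Equiv.ofBijective_apply, proj, h2]
    congr
  rw [h1, ← Equiv.sum_comp (Equiv.sumArrowEquivProdArrow V U Bool).symm,
    Fintype.sum_prod_type_right, measuredProb]
  refine Finset.sum_congr rfl fun u _ => ?_
  have hx : ∀ b : V → Bool, φ (Sum.elim b u) = C.run (proj (fun b => G b = u) ψ) b := by
    intro b
    rw [hφ, run_inl_attach_apply]
    rfl
  have hτu : ∀ b : V → Bool, τ (Sum.elim b u) (.inr out) = xor (u out) (b ans && u flag) := by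
    intro b
    simp [τ]
  change ∑ b : V → Bool, ‖if τ (Sum.elim b u) (.inr out) = true then φ (Sum.elim b u) else 0‖ ^ 2
    = _
  simp only [hx, hτu]
  cases ho : u out
  · cases hf : u flag
    · rw [proj_eq_zero (P := fun b => G b flag = true ∧ G b = u), acceptProb_zero]
      · simp
      · rintro b ⟨h, rfl⟩
        simp [h] at hf
    · rw [acceptProb, normSq, proj_congr (P := fun b => G b flag = true ∧ G b = u)
        (Q := fun b => G b = u)]
      · refine Finset.sum_congr rfl fun b _ => ?_
        by_cases hb : b ans = true <;> simp [proj, hb]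
      · intro b
        exact and_iff_right_of_imp fun h => by rw [h, hf]
  · have h0 : ∀ b, G b ≠ u := by
      rintro b rfl
      simp [hG] at ho
    rw [proj_eq_zero h0, Circuit.run_zero,
      proj_eq_zero (P := fun b => G b flag = true ∧ G b = u) fun b h => h0 b h.2, acceptProb_zero]
    simp

end Attach

/-! ### Renaming wires -/

section Relabel

variable {W W' : Type} [Fintype W] [DecidableEq W] [Fintype W'] [DecidableEq W']

/-- The state in which the wires are renamed. -/
def relabel (e : W ≃ W') (ψ : State W) : State W' := fun b => ψ (b ∘ e)

theorem run_relabel (e : W ≃ W') (C : Circuit W) (ψ : State W) :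
    Circuit.run (Circuit.map e.toEmbedding C) (relabel e ψ) = relabel e (C.run ψ) := by
  funext x
  rw [run_map_apply, relabel]
  congr 2
  funext b
  refine congrArg ψ (funext fun w => ?_)
  exact e.injective.extend_apply _ _ w

theorem proj_relabel (e : W ≃ W') (P : (W' → Bool) → Prop) (ψ : State W) :
    proj P (relabel e ψ) = relabel e (proj (fun b => P (b ∘ e.symm)) ψ) := by
  funext x
  have : x ∘ e ∘ e.symm = x := by rw [Equiv.self_comp_symm, Function.comp_id]
  have hP : P x ↔ P (x ∘ e ∘ e.symm) := by rw [this]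
  simp only [proj, relabel, Function.comp_assoc]
  by_cases h' : P x
  · rw [if_pos h', if_pos (hP.1 h')]
  · rw [if_neg h', if_neg (mt hP.2 h')]

theorem normSq_relabel (e : W ≃ W') (ψ : State W) : normSq (relabel e ψ) = normSq ψ := by
  rw [normSq, normSq, ← Equiv.sum_comp (e.arrowCongr (Equiv.refl Bool))]
  refine Finset.sum_congr rfl fun b _ => ?_
  rw [relabel]
  congr 3
  funext w
  simp

theorem acceptProb_relabel (e : W ≃ W') (C : Circuit W) (o : W) (ψ : State W) :
    acceptProb (Circuit.map e.toEmbedding C) (e o) (relabel e ψ) = acceptProb C o ψ := by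
  rw [acceptProb, run_relabel, proj_relabel, normSq_relabel, acceptProb]
  simp

theorem ket_eq_relabel (e : W ≃ W') (b : W' → Bool) : ket b = relabel e (ket (b ∘ e)) := by
  funext x
  rw [relabel, ket_apply, ket_apply]
  refine if_congr ⟨fun h => by rw [h], fun h => funext fun w => ?_⟩ rfl rfl
  simpa using congrFun h (e.symm w)

end Relabel

/-! ### The reduction -/

section Reduction

/-- The registers of the collapsing experiment for hash functions, with work qubits labelled by an
arbitrary type. -/
noncomputable def hashWireEquiv (κ n m : ℕ) (V E : Type) [Fintype V] [Fintype E] :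
    V ⊕ (Fin κ ⊕ (Fin n ⊕ (Fin m ⊕ E))) ≃ HashWire κ n m (Fintype.card (V ⊕ E)) where
  toFun
    | .inl v => .work (Fintype.equivFin (V ⊕ E) (.inl v))
    | .inr (.inl i) => .key i
    | .inr (.inr (.inl i)) => .inp i
    | .inr (.inr (.inr (.inl i))) => .out i
    | .inr (.inr (.inr (.inr x))) => .work (Fintype.equivFin (V ⊕ E) (.inr x))
  invFun
    | .key i => .inr (.inl i)
    | .inp i => .inr (.inr (.inl i))
    | .out i => .inr (.inr (.inr (.inl i)))
    | .work i => ((Fintype.equivFin (V ⊕ E)).symm i).map id fun x => .inr (.inr (.inr x))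
  left_inv := by rintro (v | (i | (i | (i | x)))) <;> simp
  right_inv := by
    rintro (i | i | i | i)
    · rfl
    · rfl
    · rfl
    · obtain ⟨x, rfl⟩ := (Fintype.equivFin (V ⊕ E)).surjective i
      rcases x with v | x <;> simp

/-- `Pr[Exp_b = 1]` for a fixed key `k`, in the collapsing experiment for hash functions. -/
noncomputable def hashExp {κ n m : ℕ} (ev : Bits κ → Bits n → Bits m) (A : HashAdversary κ n m)
    (k : Bits κ) (b : Bool) : ℝ :=
  ∑ y : Bits m,
    let φ := proj (fun β => (fun i => β (.out i)) = y)
      (A.first.run (ket (hashInit k (fun _ => false) (fun _ => false))))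
    let χ := proj (fun β => ev k (fun i => β (.inp i)) = y) φ
    if b then
      ∑ x : Bits n, acceptProb A.second A.answer (proj (fun β => (fun i => β (.inp i)) = x) χ)
    else acceptProb A.second A.answer χ

theorem collapseProb_eq_sum_hashExp (H : HashFamily) (l : ℕ)
    (A : HashAdversary (H.keyLen l) (H.inLen l) (H.outLen l)) (b : Bool) :
    H.collapseProb l A b = ∑ k, (H.keyDist l k).toReal * hashExp (H.eval l) A k b := rfl

section Wires

variable {κ n m : ℕ} {V ρ A₁ A₂ : Type}

/-- The wires that the reduction adjoins to those of the given adversary: the key, the hash input,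
the hash output, the record, the flag, its answer, and ancillas for two circuits. -/
abbrev AdjWire (κ n m : ℕ) (ρ A₁ A₂ : Type) : Type :=
  Fin κ ⊕ (Fin n ⊕ (Fin m ⊕ (ρ ⊕ (Unit ⊕ (Unit ⊕ (A₁ ⊕ A₂))))))

/-- The wires of the circuit that fills the registers of the reduction. -/
def fillWire : ((Fin κ ⊕ V) ⊕ (Fin n ⊕ (Fin m ⊕ (ρ ⊕ Unit)))) ⊕ A₁ → V ⊕ AdjWire κ n m ρ A₁ A₂
  | .inl (.inl (.inl i)) => .inr (.inl i)
  | .inl (.inl (.inr v)) => .inl v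
  | .inl (.inr (.inl i)) => .inr (.inr (.inl i))
  | .inl (.inr (.inr (.inl i))) => .inr (.inr (.inr (.inl i)))
  | .inl (.inr (.inr (.inr (.inl r)))) => .inr (.inr (.inr (.inr (.inl r))))
  | .inl (.inr (.inr (.inr (.inr _)))) => .inr (.inr (.inr (.inr (.inr (.inl ())))))
  | .inr a => .inr (.inr (.inr (.inr (.inr (.inr (.inr (.inl a)))))))

theorem fillWire_injective : Function.Injective
    (fillWire : _ → V ⊕ AdjWire κ n m ρ A₁ A₂) := by
  let g : V ⊕ AdjWire κ n m ρ A₁ A₂ →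
      Option (((Fin κ ⊕ V) ⊕ (Fin n ⊕ (Fin m ⊕ (ρ ⊕ Unit)))) ⊕ A₁) := fun
    | .inr (.inl i) => some (.inl (.inl (.inl i)))
    | .inl v => some (.inl (.inl (.inr v)))
    | .inr (.inr (.inl i)) => some (.inl (.inr (.inl i)))
    | .inr (.inr (.inr (.inl i))) => some (.inl (.inr (.inr (.inl i))))
    | .inr (.inr (.inr (.inr (.inl r)))) => some (.inl (.inr (.inr (.inr (.inl r)))))
    | .inr (.inr (.inr (.inr (.inr (.inl _))))) => some (.inl (.inr (.inr (.inr (.inr ())))))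
    | .inr (.inr (.inr (.inr (.inr (.inr (.inr (.inl a))))))) => some (.inr a)
    | _ => none
  refine Function.Injective.of_comp (f := g) fun x y h => Option.some_injective _ ?_
  have hg : ∀ x, g (fillWire x) = some x := by
    rintro (((_ | _) | (_ | (_ | (_ | _)))) | _) <;> rfl
  rw [← hg, ← hg]
  exact h

/-- The wires of the circuit that resets the hash input of the reduction. -/
def resetWire : ((Fin κ ⊕ V) ⊕ Fin n) ⊕ A₂ → V ⊕ AdjWire κ n m ρ A₁ A₂
  | .inl (.inl (.inl i)) => .inr (.inl i)
  | .inl (.inl (.inr v)) => .inl v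
  | .inl (.inr i) => .inr (.inr (.inl i))
  | .inr a => .inr (.inr (.inr (.inr (.inr (.inr (.inr (.inr a)))))))

theorem resetWire_injective : Function.Injective
    (resetWire : _ → V ⊕ AdjWire κ n m ρ A₁ A₂) := by
  let g : V ⊕ AdjWire κ n m ρ A₁ A₂ → Option (((Fin κ ⊕ V) ⊕ Fin n) ⊕ A₂) := fun
    | .inr (.inl i) => some (.inl (.inl (.inl i)))
    | .inl v => some (.inl (.inl (.inr v)))
    | .inr (.inr (.inl i)) => some (.inl (.inr i))
    | .inr (.inr (.inr (.inr (.inr (.inr (.inr (.inr a))))))) => some (.inr a)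
    | _ => none
  refine Function.Injective.of_comp (f := g) fun x y h => Option.some_injective _ ?_
  have hg : ∀ x, g (resetWire x) = some x := by
    rintro (((_ | _) | _) | _) <;> rfl
  rw [← hg, ← hg]
  exact h

end Wires

variable {V ρ : Type} [Fintype V] [DecidableEq V] [Fintype ρ] [DecidableEq ρ]

set_option synthInstance.maxSize 1000 in
/-- An adversary acts on the wires `V` by `C₁`, and by `C₂` when it gets its registers back. Let `X`
be a hash input, `R` a record and `ver` a flag, all computed from its registers, such that on the
branches that are flagged the record determines the hash of `X`. Then some adversary against the
hash function distinguishes as well as `C₂` does whether, next to the record, `X` is measured: it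
evaluates `X`, its hash, `R` and `ver` coherently, submits `X` and the hash, and keeps `R`
and `ver`, which amounts to measuring them. -/
theorem exists_hashAdversary {κ n m : ℕ} (ev : Bits κ → Bits n → Bits m) (keyW : Fin κ → V)
    (hkeyW : Function.Injective keyW)
    (start : Bits κ → V → Bool) (hs₁ : ∀ k i, start k (keyW i) = k i)
    (hs₂ : ∀ k w, (∀ i, keyW i ≠ w) → start k w = false)
    (C₁ C₂ : Circuit V) (ans : V) (X : (Fin κ ⊕ V → Bool) → Bits n)
    (R : (Fin κ ⊕ V → Bool) → ρ → Bool) (ver : (Fin κ ⊕ V → Bool) → Bool) {sF sX : ℕ}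
    (hF : HasCleanCircuit (fun b => Sum.elim (X b) (Sum.elim (ev (b ∘ Sum.inl) (X b))
      (Sum.elim (R b) fun _ : Unit => ver b))) sF)
    (hX : HasCleanCircuit X sX)
    (hdet : ∀ (k : Bits κ) (b b' : V → Bool), ver (Sum.elim k b) = true →
      ver (Sum.elim k b') = true → R (Sum.elim k b) = R (Sum.elim k b') →
      ev k (X (Sum.elim k b)) = ev k (X (Sum.elim k b'))) :
    ∃ B : HashAdversary κ n m,
      B.size ≤ C₁.length + C₂.length + sF + sX + 2 * κ + n + m +
        Fintype.card V + Fintype.card ρ + 3 ∧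
      (∀ k, hashExp ev B k false = measuredProb C₂ ans (fun b => ver (Sum.elim k b) = true)
        (fun b => R (Sum.elim k b)) (C₁.run (ket (start k)))) ∧
      ∀ k, hashExp ev B k true = measuredProb C₂ ans (fun b => ver (Sum.elim k b) = true)
        (fun b => (R (Sum.elim k b), X (Sum.elim k b))) (C₁.run (ket (start k))) := by
  obtain ⟨A₁, iF, iD, CF, hCF, hmF⟩ := hF
  obtain ⟨A₂, jF, jD, CX, hCX, hmX⟩ := hX
  let flag : AdjWire κ n m ρ A₁ A₂ := .inr (.inr (.inr (.inr (.inl ()))))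
  let out : AdjWire κ n m ρ A₁ A₂ := .inr (.inr (.inr (.inr (.inr (.inl ())))))
  have hne : flag ≠ out := fun h => by
    simp only [flag, out, Sum.inr.injEq, reduceCtorEq] at h
  let eF : _ ↪ V ⊕ AdjWire κ n m ρ A₁ A₂ := ⟨fillWire, fillWire_injective⟩
  let eX : _ ↪ V ⊕ AdjWire κ n m ρ A₁ A₂ := ⟨resetWire, resetWire_injective⟩
  let cp : Circuit (V ⊕ AdjWire κ n m ρ A₁ A₂) := copyCircuit (fun i : Fin κ => .inr (.inl i))
    (fun i => .inl (keyW i)) (by simp)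
  let D₁ : Circuit (V ⊕ AdjWire κ n m ρ A₁ A₂) := cp ++ (Circuit.map .inl C₁ ++ Circuit.map eF CF)
  let D₂ : Circuit (V ⊕ AdjWire κ n m ρ A₁ A₂) := Circuit.map .inl C₂ ++
    [.toffoli (.inl ans) (.inr flag) (.inr out) (by simp) (by simp) (by simpa using hne)]
  let e : V ⊕ AdjWire κ n m ρ A₁ A₂ ≃ HashWire κ n m (Fintype.card _) := hashWireEquiv κ n m V _
  -- the contents of the adjoined wires when the challenger acts, and after `X` has been reset
  let G : Bits κ → (V → Bool) → AdjWire κ n m ρ A₁ A₂ → Bool := fun k b =>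
    Sum.elim k (Sum.elim (X (Sum.elim k b)) (Sum.elim (ev k (X (Sum.elim k b)))
      (Sum.elim (R (Sum.elim k b)) (Sum.elim (fun _ => ver (Sum.elim k b)) fun _ => false))))
  let G' : Bits κ → (V → Bool) → AdjWire κ n m ρ A₁ A₂ → Bool := fun k b =>
    Sum.elim k (Sum.elim (fun _ => false) (Sum.elim (ev k (X (Sum.elim k b)))
      (Sum.elim (R (Sum.elim k b)) (Sum.elim (fun _ => ver (Sum.elim k b)) fun _ => false))))
  have hGF : ∀ k b, Maps (Circuit.map eF CF)
      (Sum.elim b (Sum.elim k fun _ => false)) (Sum.elim b (G k b)) := by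
    intro k b
    refine (hmF (Sum.elim k b) fun _ => false).map eF ?_ ?_ ?_
    · rintro (((_ | _) | (_ | (_ | (_ | _)))) | _) <;> rfl
    · rintro (((_ | _) | (_ | (_ | (_ | _)))) | _) <;>
        simp only [Sum.elim_inl, Sum.elim_inr, Bool.false_xor] <;> rfl
    · rintro (v | (i | (i | (i | (r | (_ | (_ | (a | a)))))))) hw
      · rfl
      · rfl
      · exact absurd rfl (hw (.inl (.inr (.inl i))))
      · exact absurd rfl (hw (.inl (.inr (.inr (.inl i)))))
      · exact absurd rfl (hw (.inl (.inr (.inr (.inr (.inl r))))))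
      · exact absurd rfl (hw (.inl (.inr (.inr (.inr (.inr ()))))))
      · rfl
      · rfl
      · rfl
  have hGX : ∀ k b, Maps (Circuit.map eX CX) (Sum.elim b (G k b)) (Sum.elim b (G' k b)) := by
    intro k b
    refine (hmX (Sum.elim k b) (X (Sum.elim k b))).map eX ?_ ?_ ?_
    · rintro (((_ | _) | _) | _) <;> rfl
    · rintro (((_ | _) | _) | _) <;>
        simp only [Sum.elim_inl, Sum.elim_inr, Bool.xor_self] <;> rfl
    · rintro (v | (i | (i | (i | (r | (_ | (_ | (a | a)))))))) hw
      · rfl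
      · rfl
      · exact absurd rfl (hw (.inl (.inr i)))
      all_goals rfl
  have hstart : ∀ k, Circuit.run (Circuit.map e.toEmbedding D₁)
      (ket (hashInit k (fun _ => false) fun _ => false)) =
      relabel e (attach (G k) (C₁.run (ket (start k)))) := by
    intro k
    have h0 : (hashInit k (fun _ => false) (fun _ => false) ∘ e : V ⊕ AdjWire κ n m ρ A₁ A₂ → Bool) =
        Sum.elim (fun _ => false) (Sum.elim k fun _ => false) := by
      funext w
      rcases w with v | (i | (i | (i | x))) <;> rfl
    have h1 : Maps cp (Sum.elim (fun _ => false) (Sum.elim k fun _ => false))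
        (Sum.elim (start k) (Sum.elim k fun _ => false)) := by
      refine maps_copyCircuit _ (fun i j h => hkeyW (by simpa using h)) ?_ ?_
      · intro i
        simp [hs₁]
      · rintro (v | u) hw
        · exact (hs₂ k v fun i hi => hw i (by rw [hi])).symm
        · rfl
    rw [ket_eq_relabel e, run_relabel, h0, Circuit.run_append, h1, ket_sumElim,
      Circuit.run_append, run_inl_attach_const, run_attach fun b => hGF k b]
  have hend : ∀ k ψ, acceptProb (Circuit.map e.toEmbedding (Circuit.map eX CX ++ D₂))
      (e (.inr out)) (relabel e (attach (G k) ψ)) =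
      measuredProb C₂ ans (fun b => ver (Sum.elim k b) = true) (G' k) ψ := by
    intro k ψ
    rw [acceptProb_relabel, acceptProb_append, run_attach (hGX k)]
    exact acceptProb_toffoli_attach C₂ ans hne (fun b => rfl) ψ
  have hout : ∀ k y ψ, proj (fun β => (fun i => β (.out i)) = y) (relabel e (attach (G k) ψ)) =
      relabel e (attach (G k) (proj (fun b => ev k (X (Sum.elim k b)) = y) ψ)) := by
    intro k y ψ
    rw [proj_relabel, proj_attach]
    rfl
  have hinp : ∀ k (P : Bits n → Prop) ψ,
      proj (fun β => P (fun i => β (.inp i))) (relabel e (attach (G k) ψ)) =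
      relabel e (attach (G k) (proj (fun b => P (X (Sum.elim k b))) ψ)) := by
    intro k P ψ
    rw [proj_relabel, proj_attach]
    rfl
  refine ⟨⟨_, Circuit.map e.toEmbedding D₁, Circuit.map e.toEmbedding (Circuit.map eX CX ++ D₂),
    e (.inr out)⟩, ?_, ?_, ?_⟩
  · simp only [HashAdversary.size, D₁, D₂, cp, Circuit.length_map, List.length_append,
      length_copyCircuit, Fintype.card_sum, Fintype.card_fin, Fintype.card_unit,
      List.length_singleton]
    omega
  · intro k
    rw [hashExp]
    simp only [Bool.false_eq_true, if_false]
    have : ∀ y, acceptProb (Circuit.map e.toEmbedding (Circuit.map eX CX ++ D₂)) (e (.inr out))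
        (proj (fun β => ev k (fun i => β (.inp i)) = y)
          (proj (fun β => (fun i => β (.out i)) = y) (Circuit.run (Circuit.map e.toEmbedding D₁)
            (ket (hashInit k (fun _ => false) fun _ => false))))) =
        ∑ u, acceptProb C₂ ans (proj (fun b => ver (Sum.elim k b) = true ∧
          (ev k (X (Sum.elim k b)), G' k b) = (y, u)) (C₁.run (ket (start k)))) := by
      intro y
      rw [hstart, hout, hinp k fun x => ev k x = y, hend, measuredProb]
      refine Finset.sum_congr rfl fun u _ => ?_
      rw [proj_proj, proj_proj]
      congr 1
      refine proj_congr (fun b => ?_) _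
      rw [Prod.mk.injEq]
      tauto
    refine (Finset.sum_congr rfl fun y _ => this y).trans ?_
    rw [← Fintype.sum_prod_type', ← measuredProb]
    refine measuredProb_congr _ _ _ fun b b' hb hb' => ?_
    rw [Prod.mk.injEq]
    constructor
    · rintro ⟨-, h⟩
      exact funext fun r => congrFun h (.inr (.inr (.inr (.inl r))))
    · -- measuring the hash of `X` adds nothing to measuring the record
      intro h
      have := hdet k b b' hb hb' h
      simp only [G', this, h, hb, hb', and_self]
  · intro k
    rw [hashExp]
    simp only [if_true]
    have : ∀ y x, acceptProb (Circuit.map e.toEmbedding (Circuit.map eX CX ++ D₂)) (e (.inr out))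
        (proj (fun β => (fun i => β (.inp i)) = x)
        (proj (fun β => ev k (fun i => β (.inp i)) = y)
          (proj (fun β => (fun i => β (.out i)) = y) (Circuit.run (Circuit.map e.toEmbedding D₁)
            (ket (hashInit k (fun _ => false) fun _ => false)))))) =
        ∑ u, acceptProb C₂ ans (proj (fun b => ver (Sum.elim k b) = true ∧
          (ev k (X (Sum.elim k b)), X (Sum.elim k b), G' k b) = (y, x, u))
            (C₁.run (ket (start k)))) := by
      intro y x
      rw [hstart, hout, hinp k fun x => ev k x = y, hinp k fun x' => x' = x, hend,
        measuredProb]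
      refine Finset.sum_congr rfl fun u _ => ?_
      rw [proj_proj, proj_proj, proj_proj]
      congr 1
      refine proj_congr (fun b => ?_) _
      rw [Prod.mk.injEq, Prod.mk.injEq]
      tauto
    refine (Finset.sum_congr rfl fun y _ => Finset.sum_congr rfl fun x _ => this y x).trans ?_
    simp only [← Fintype.sum_prod_type']
    change measuredProb C₂ ans (fun b => ver (Sum.elim k b) = true)
      (fun b => (ev k (X (Sum.elim k b)), X (Sum.elim k b), G' k b)) (C₁.run (ket (start k))) = _
    refine measuredProb_congr _ _ _ fun b b' hb hb' => ?_
    rw [Prod.mk.injEq, Prod.mk.injEq, Prod.mk.injEq]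
    constructor
    · rintro ⟨-, hx, h⟩
      exact ⟨funext fun r => congrFun h (.inr (.inr (.inr (.inl r)))), hx⟩
    · rintro ⟨h, hx⟩
      simp only [G', h, hx, hb, hb', and_self]

end Reduction

/-! ### Well-formed queries -/

section Query

variable {κ c σ N s t a : ℕ}

/-- The position encoded by the `j`-th entry of the list of positions. -/
def position (β : VCWire κ c σ N s t a → Bool) (j : Fin s) : ℕ := Nat.ofBits fun i => β (.pos j i)

/-- `Q` is encoded by the registers `used` and `pos`, and there is room for opening it, where `r` is
the length of the opening proof for a single position. -/
def Encodes (r : ℕ) (β : VCWire κ c σ N s t a → Bool) (Q : Finset (Fin N)) : Prop :=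
  (Q.card ≤ s ∧ Q.card * r ≤ t) ∧ HoldsQuery Q β

/-- The `j`-th entry of the list of positions is as in the encoding of a set. -/
def WellFormedAt (r : ℕ) (β : VCWire κ c σ N s t a → Bool) (j : Fin s) : Prop :=
  (β (.used j) = true → position β j < N ∧ (j.val + 1) * r ≤ t) ∧
  (β (.used j) = false → ∀ i, β (.pos j i) = false) ∧
  ∀ h : j.val + 1 < s, β (.used ⟨j.val + 1, h⟩) = true →
    β (.used j) = true ∧ position β j < position β ⟨j.val + 1, h⟩

theorem HoldsQuery.used_iff {β : VCWire κ c σ N s t a → Bool} {Q : Finset (Fin N)}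
    (h : HoldsQuery Q β) (j : Fin s) : β (.used j) = true ↔ j.val < Q.card := by
  rw [(h j).1, decide_eq_true_iff]

theorem HoldsQuery.pos_eq {β : VCWire κ c σ N s t a → Bool} {Q : Finset (Fin N)}
    (h : HoldsQuery Q β) {j : Fin s} (hj : j.val < Q.card) (i : Fin (Nat.clog 2 N)) :
    β (.pos j i) = (Q.orderEmbOfFin rfl ⟨j, hj⟩).val.testBit i := by
  rw [(h j).2 i, dif_pos hj]

theorem HoldsQuery.position_eq {β : VCWire κ c σ N s t a → Bool} {Q : Finset (Fin N)}
    (h : HoldsQuery Q β) {j : Fin s} (hj : j.val < Q.card) :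
    position β j = (Q.orderEmbOfFin rfl ⟨j, hj⟩).val := by
  simp only [position, h.pos_eq hj]
  rw [Nat.ofBits_testBit, Nat.mod_eq_of_lt]
  exact lt_of_lt_of_le (Fin.isLt _) (Nat.le_pow_clog one_lt_two N)

theorem Encodes.mem_iff {r : ℕ} {β : VCWire κ c σ N s t a → Bool} {Q : Finset (Fin N)}
    (h : Encodes r β Q) (x : Fin N) :
    x ∈ Q ↔ ∃ j, β (.used j) = true ∧ position β j = x.val := by
  constructor
  · intro hx
    have hr := (rank Q ⟨x, hx⟩).isLt
    refine ⟨⟨rank Q ⟨x, hx⟩, hr.trans_le h.1.1⟩, (h.2.used_iff _).2 hr, ?_⟩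
    rw [h.2.position_eq (j := ⟨rank Q ⟨x, hx⟩, hr.trans_le h.1.1⟩) hr]
    change (Q.orderIsoOfFin rfl ((Q.orderIsoOfFin rfl).symm ⟨x, hx⟩)).val.val = x.val
    rw [OrderIso.apply_symm_apply]
  · rintro ⟨j, hj, hx⟩
    have hj' := (h.2.used_iff j).1 hj
    rw [h.2.position_eq hj'] at hx
    rw [← Fin.ext hx]
    exact Q.orderEmbOfFin_mem rfl _

theorem Encodes.unique {r : ℕ} {β β' : VCWire κ c σ N s t a → Bool} {Q Q' : Finset (Fin N)}
    (h : Encodes r β Q) (h' : Encodes r β' Q') (hu : ∀ j, β (.used j) = β' (.used j))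
    (hp : ∀ j i, β (.pos j i) = β' (.pos j i)) : Q = Q' := by
  ext x
  rw [h.mem_iff, h'.mem_iff]
  simp only [position, hu, hp]

theorem HoldsQuery.congr {β β' : VCWire κ c σ N s t a → Bool} {Q : Finset (Fin N)}
    (h : HoldsQuery Q β) (h' : HoldsQuery Q β') :
    (∀ j, β (.used j) = β' (.used j)) ∧ ∀ j i, β (.pos j i) = β' (.pos j i) :=
  ⟨fun j => by rw [(h j).1, (h' j).1], fun j i => by rw [(h j).2, (h' j).2]⟩

/-- Whether a set is encoded can be checked slot by slot, which is how it is computed by a circuit. -/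
theorem exists_encodes_iff {r : ℕ} {β : VCWire κ c σ N s t a → Bool} :
    (∃ Q, Encodes r β Q) ↔ ∀ j, WellFormedAt r β j := by
  constructor
  · rintro ⟨Q, ⟨hs, ht⟩, hQ⟩ j
    refine ⟨fun hj => ?_, fun hj i => ?_, fun hj₁ hu => ?_⟩
    · rw [hQ.used_iff] at hj
      rw [hQ.position_eq hj]
      exact ⟨Fin.isLt _, (Nat.mul_le_mul_right r hj).trans ht⟩
    · have : ¬ j.val < Q.card := fun h => by simp [(hQ.used_iff j).2 h] at hj
      rw [(hQ j).2, dif_neg this]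
    · rw [hQ.used_iff] at hu
      have hj : j.val < Q.card := (Nat.lt_succ_self _).trans hu
      refine ⟨(hQ.used_iff j).2 hj, ?_⟩
      rw [hQ.position_eq hj, hQ.position_eq (j := ⟨j.val + 1, hj₁⟩) hu, Fin.val_fin_lt]
      exact (Q.orderEmbOfFin rfl).strictMono (Nat.lt_succ_self _)
  · intro h
    -- `q` is the first unused slot
    have hex : ∃ q, ¬ ∃ hq : q < s, β (.used ⟨q, hq⟩) = true := ⟨s, by simp⟩
    classical
    let q := Nat.find hex
    have hq : ∀ j, (∃ hj : j < s, β (.used ⟨j, hj⟩) = true) ↔ j < q := by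
      intro j
      refine ⟨fun hj => ?_, fun hj => not_not.1 (Nat.find_min hex hj)⟩
      by_contra hlt
      rw [not_lt] at hlt
      induction j, hlt using Nat.le_induction with
      | base => exact Nat.find_spec hex hj
      | succ j hlt ih =>
        obtain ⟨hj₁, hu⟩ := hj
        exact ih ⟨_, ((h ⟨j, by omega⟩).2.2 hj₁ hu).1⟩
    have hqs : q ≤ s := by
      by_contra hlt
      obtain ⟨hj, -⟩ := (hq s).2 (by omega)
      exact lt_irrefl _ hj
    have hused : ∀ j : Fin q, β (.used (Fin.castLE hqs j)) = true := fun j =>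
      ((hq j).2 j.isLt).2
    let f : Fin q → Fin N := fun j =>
      ⟨position β (Fin.castLE hqs j), ((h _).1 (hused j)).1⟩
    have hf : StrictMono f := by
      have key : ∀ i j : ℕ, i < j → ∀ (hi : i < s) (hj : j < s), j < q →
          position β ⟨i, hi⟩ < position β ⟨j, hj⟩ := by
        intro i j hij
        induction j, hij using Nat.le_induction with
        | base =>
          intro hi hj hjq
          exact ((h ⟨i, hi⟩).2.2 hj ((hq _).2 hjq).2).2
        | succ j hij ih =>
          intro hi hj hjq
          exact (ih hi (by omega) (by omega)).trans
            ((h ⟨j, by omega⟩).2.2 hj ((hq _).2 hjq).2).2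
      intro i j hij
      exact key i j hij _ _ j.isLt
    let Q : Finset (Fin N) := Finset.univ.map ⟨f, hf.injective⟩
    have hc : Q.card = q := by simp [Q]
    have hfQ : f = Q.orderEmbOfFin hc := Finset.orderEmbOfFin_unique hc (by simp [Q]) hf
    have hpos : ∀ (j : Fin s) (hj : j.val < Q.card),
        (Q.orderEmbOfFin rfl ⟨j, hj⟩).val = position β j := by
      intro j hj
      have hj' : j.val < q := hc ▸ hj
      have : Q.orderEmbOfFin rfl ⟨j, hj⟩ = Q.orderEmbOfFin hc ⟨j, hj'⟩ := by
        rw [Finset.orderEmbOfFin_eq_orderEmbOfFin_iff]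
      rw [this, ← hfQ]
      rfl
    refine ⟨Q, ⟨hc ▸ hqs, ?_⟩, fun j => ?_⟩
    · rw [hc]
      rcases Nat.eq_zero_or_pos q with h0 | h0
      · simp [h0]
      · have := ((h _).1 (hused ⟨q - 1, by omega⟩)).2
        simpa [Nat.sub_add_cancel h0] using this
    · have hju : β (.used j) = true ↔ j.val < Q.card := by
        rw [hc, ← hq]
        simp
      refine ⟨by rw [Bool.eq_iff_iff, hju, decide_eq_true_iff], fun i => ?_⟩
      by_cases hj : j.val < Q.card
      · rw [dif_pos hj, hpos, position, Nat.testBit_ofBits_lt _ _ i.isLt]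
      · rw [dif_neg hj]
        exact (h j).2.1 (by simpa using mt hju.1 hj) i

end Query

/-! ### Authentication paths as chains of preimages -/

section Paths

variable {κ n m N s t a : ℕ}

/-- The `k`-th string of the authentication path of the `j`-th slot, read from the register for the
opening proof. The bits for which this register has no room, which do not occur in well-formed
queries, are set to `false`. -/
def pathEntry (β : VCWire κ m n N s t a → Bool) (j : Fin s) (k : ℕ) : Bits m := fun r =>
  if h : r.val + m * k + Nat.clog 2 N * m * j.val < t then β (.prf ⟨_, h⟩) else false

/-- The `k`-th bit of the position of the `j`-th slot. -/
def positionBit (β : VCWire κ m n N s t a → Bool) (j : Fin s) (k : ℕ) : Bool :=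
  if h : k < Nat.clog 2 N then β (.pos j ⟨k, h⟩) else false

/-- The hash input that yields the node on level `k` of the path of the `j`-th slot: the symbol for
`k = 0`, and otherwise the pair of the node on the level below and its sibling. -/
def preimage (hn : n = m + m) (h : Bits n → Bits m) (β : VCWire κ m n N s t a → Bool)
    (j : Fin s) : ℕ → Bits n
  | 0 => fun e => β (.val j e)
  | k + 1 => fun e =>
    if positionBit β j k then
      Fin.append (pathEntry β j k) (h (preimage hn h β j k)) (Fin.cast hn e)
    else Fin.append (h (preimage hn h β j k)) (pathEntry β j k) (Fin.cast hn e)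

theorem pathRoot_eq_preimage (hn : n = m + m) (h : Bits n → Bits m)
    (β : VCWire κ m n N s t a → Bool) (j : Fin s) (i : ℕ) (v : Bits n)
    (hv : ∀ e, v e = β (.val j e)) (d : ℕ) (path : Fin d → Bits m)
    (hb : ∀ k < d, i.testBit k = positionBit β j k) (hp : ∀ k : Fin d, path k = pathEntry β j k) :
    pathRoot hn h i v d path = h (preimage hn h β j d) := by
  induction d with
  | zero => exact congrArg h (funext hv)
  | succ d ih =>
    rw [pathRoot, ih _ (fun k hk => hb k (hk.trans (Nat.lt_succ_self d))) fun k => hp k.castSucc,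
      hb d (Nat.lt_succ_self d), hp (Fin.last d)]
    rw [preimage, hashPair, hashPair]
    cases positionBit β j d <;> rfl

theorem append_inj {x y x' y' : Bits m} (h : Fin.append x y = Fin.append x' y') :
    x = x' ∧ y = y' :=
  ⟨funext fun i => by simpa only [Fin.append_left] using congrFun h (Fin.castAdd m i),
    funext fun i => by simpa only [Fin.append_right] using congrFun h (Fin.natAdd m i)⟩

/-- The pair of a node and its sibling determines both. -/
theorem preimage_succ_inj {hn : n = m + m} {h : Bits n → Bits m}
    {β β' : VCWire κ m n N s t a → Bool} {j : Fin s} {k : ℕ}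
    (hb : positionBit β j k = positionBit β' j k)
    (he : preimage hn h β j (k + 1) = preimage hn h β' j (k + 1)) :
    h (preimage hn h β j k) = h (preimage hn h β' j k) ∧ pathEntry β j k = pathEntry β' j k := by
  rw [preimage, preimage, hb] at he
  have hcast : ∀ f g : Bits (m + m), (fun e => f (Fin.cast hn e)) = (fun e => g (Fin.cast hn e)) →
      f = g := by
    intro f g hfg
    funext e
    simpa using congrFun hfg (Fin.cast hn.symm e)
  cases hb' : positionBit β' j k
  · rw [hb'] at he
    exact append_inj (hcast _ _ (by simpa using he))
  · rw [hb'] at he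
    exact (append_inj (hcast _ _ (by simpa using he))).symm

/-- The branches in which the adversary sends a well-formed message and the verifier accepts. -/
def Accepted (hn : n = m + m) (h : Bits n → Bits m) (β : VCWire κ m n N s t a → Bool) : Prop :=
  ∀ j, WellFormedAt (Nat.clog 2 N * m) β j ∧
    (β (.used j) = true → h (preimage hn h β j (Nat.clog 2 N)) = fun i => β (.com i))

theorem verify_iff (hn : n = m + m) (h : Bits n → Bits m) {β : VCWire κ m n N s t a → Bool}
    {Q : Finset (Fin N)} (hQ : Encodes (Nat.clog 2 N * m) β Q) (cm : Bits m) :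
    (∀ i : Q, pathRoot hn h i.val.val (valPart Q hQ.1.1 β i) (Nat.clog 2 N)
      (fun k r => prfPart hQ.1.2 β (finProdFinEquiv (rank Q i, finProdFinEquiv (k, r)))) = cm) ↔
    ∀ j, β (.used j) = true → h (preimage hn h β j (Nat.clog 2 N)) = cm := by
  have key : ∀ i : Q, pathRoot hn h i.val.val (valPart Q hQ.1.1 β i) (Nat.clog 2 N)
      (fun k r => prfPart hQ.1.2 β (finProdFinEquiv (rank Q i, finProdFinEquiv (k, r)))) =
      h (preimage hn h β (Fin.castLE hQ.1.1 (rank Q i)) (Nat.clog 2 N)) := by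
    intro i
    refine pathRoot_eq_preimage hn h β _ _ _ (fun e => rfl) _ _ ?_ ?_
    · intro k hk
      rw [positionBit, dif_pos hk, hQ.2.pos_eq (j := Fin.castLE hQ.1.1 (rank Q i))
        (rank Q i).isLt]
      change _ = (Q.orderIsoOfFin rfl ((Q.orderIsoOfFin rfl).symm i)).val.val.testBit k
      rw [OrderIso.apply_symm_apply]
    · intro k
      funext r
      have hlt : r.val + m * k.val + Nat.clog 2 N * m * (rank Q i).val < t := by
        have := (finProdFinEquiv (rank Q i, finProdFinEquiv (k, r))).isLt
        exact lt_of_lt_of_le this hQ.1.2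
      rw [pathEntry, Fin.val_castLE, dif_pos hlt]
      rfl
  constructor
  · intro hall j hj
    have hj' := (hQ.2.used_iff j).1 hj
    have := hall (Q.orderIsoOfFin rfl ⟨j, hj'⟩)
    rw [key, rank, OrderIso.symm_apply_apply] at this
    exact this
  · intro hall i
    rw [key]
    exact hall _ ((hQ.2.used_iff _).2 (rank Q i).isLt)

theorem accepted_iff {hn : n = m + m} {h : Bits n → Bits m} {β : VCWire κ m n N s t a → Bool} :
    Accepted hn h β ↔ ∃ Q, Encodes (Nat.clog 2 N * m) β Q ∧
      ∀ j, β (.used j) = true → h (preimage hn h β j (Nat.clog 2 N)) = fun i => β (.com i) := by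
  rw [Accepted, forall_and, ← exists_encodes_iff, exists_and_right]

end Paths

/-! ### The hybrids -/

section Hybrids

variable {κ n m N s t a : ℕ}

/-- `Pr[Exp_b = 1]` for a fixed key `k`, in the collapsing experiment for Merkle trees. -/
noncomputable def merkleExp (hn : n = m + m) (ev : Bits κ → Bits n → Bits m)
    (A : VCAdversary κ m n N) (k : Bits κ) (b : Bool) : ℝ :=
  ∑ cm : Bits m, ∑ Q : Finset (Fin N),
    if h : Q.card ≤ A.slots ∧ Q.card * (Nat.clog 2 N * m) ≤ A.proofCap then
      let φ := proj (fun β => (fun i => β (.com i)) = cm ∧ HoldsQuery Q β)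
        (A.first.run (ket (vcInit k)))
      let χ := proj (fun β => decide (∀ i : Q,
        pathRoot hn (ev k) i.val (valPart Q h.1 β i) (Nat.clog 2 N)
          (fun k r => prfPart h.2 β (finProdFinEquiv (rank Q i, finProdFinEquiv (k, r)))) = cm) =
            true) φ
      if b then
        ∑ v : Q → Bits n, ∑ pf : Bits (Q.card * (Nat.clog 2 N * m)),
          acceptProb A.second A.answer
            (proj (fun β => valPart Q h.1 β = v ∧ prfPart h.2 β = pf) χ)
      else acceptProb A.second A.answer χ
    else 0

theorem collapseProb_merkle_eq_sum (H : HashFamily)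
    (hn : ∀ l, H.inLen l = H.outLen l + H.outLen l) (l N : ℕ)
    (A : VCAdversary (H.keyLen l) (H.outLen l) (H.inLen l) N) (b : Bool) :
    (merkle H hn).collapseProb l N A b =
      ∑ k, (H.keyDist l k).toReal * merkleExp (hn l) (H.eval l) A k b := rfl

open Classical in
/-- The set of positions that the adversary asks to open (and `∅` if there is none). -/
noncomputable def query (β : VCWire κ m n N s t a → Bool) : Finset (Fin N) :=
  if h : ∃ Q, Encodes (Nat.clog 2 N * m) β Q then h.choose else ∅

theorem query_eq {β : VCWire κ m n N s t a → Bool} {Q : Finset (Fin N)}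
    (h : Encodes (Nat.clog 2 N * m) β Q) : query β = Q := by
  have hex : ∃ Q, Encodes (Nat.clog 2 N * m) β Q := ⟨Q, h⟩
  rw [query, dif_pos hex]
  exact hex.choose_spec.unique h (fun _ => rfl) fun _ _ => rfl

theorem Accepted.encodes {hn : n = m + m} {h : Bits n → Bits m}
    {β : VCWire κ m n N s t a → Bool} (hβ : Accepted hn h β) :
    Encodes (Nat.clog 2 N * m) β (query β) := by
  obtain ⟨Q, hQ, -⟩ := accepted_iff.1 hβ
  rwa [query_eq hQ]

/-- The chain of preimages, blanked for unused slots. -/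
def maskedPreimage (hn : n = m + m) (h : Bits n → Bits m) (β : VCWire κ m n N s t a → Bool)
    (j : Fin s) (k : ℕ) : Bits n := fun e => β (.used j) && preimage hn h β j k e

theorem maskedPreimage_of_used (hn : n = m + m) (h : Bits n → Bits m)
    {β : VCWire κ m n N s t a → Bool} {j : Fin s} (hj : β (.used j) = true) (k : ℕ) :
    maskedPreimage hn h β j k = preimage hn h β j k := by
  funext e
  rw [maskedPreimage, hj, Bool.true_and]

theorem maskedPreimage_of_not_used (hn : n = m + m) (h : Bits n → Bits m)
    {β : VCWire κ m n N s t a → Bool} {j : Fin s} (hj : β (.used j) = false) (k : ℕ) :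
    maskedPreimage hn h β j k = fun _ => false := by
  funext e
  rw [maskedPreimage, hj, Bool.false_and]

/-- The step in which the `k`-th preimage of the `j`-th slot is measured: slot by slot, and from
the root down to the symbol. -/
def step (N j k : ℕ) : ℕ := (Nat.clog 2 N + 1) * j + (Nat.clog 2 N - k)

theorem step_inj {j k j' k' : ℕ} (hk : k ≤ Nat.clog 2 N) (hk' : k' ≤ Nat.clog 2 N)
    (h : step N j k = step N j' k') : j = j' ∧ k = k' := by
  unfold step at h
  have h1 : ((Nat.clog 2 N + 1) * j + (Nat.clog 2 N - k)) / (Nat.clog 2 N + 1) = j := by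
    rw [Nat.mul_add_div (Nat.succ_pos _), Nat.div_eq_of_lt (by omega), add_zero]
  have h2 : ((Nat.clog 2 N + 1) * j' + (Nat.clog 2 N - k')) / (Nat.clog 2 N + 1) = j' := by
    rw [Nat.mul_add_div (Nat.succ_pos _), Nat.div_eq_of_lt (by omega), add_zero]
  have hj : j = j' := by rw [← h1, h, h2]
  subst hj
  exact ⟨rfl, by omega⟩

theorem step_lt {j k : ℕ} (hj : j < s) : step N j k < (Nat.clog 2 N + 1) * s := by
  have : (Nat.clog 2 N + 1) * (j + 1) ≤ (Nat.clog 2 N + 1) * s := Nat.mul_le_mul_left _ hj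
  rw [step]
  rw [mul_add, mul_one] at this
  omega

/-- The labels of the bits that are measured in the hybrids: the commitment, the registers for the
query, and the masked preimages. -/
abbrev RecordWire (n m N s : ℕ) : Type :=
  Fin m ⊕ (Fin s ⊕ ((Fin s × Fin (Nat.clog 2 N)) ⊕ ((Fin s × Fin (Nat.clog 2 N + 1)) × Fin n)))

/-- What is measured in the `T`-th hybrid: the classical message, and the masked preimages whose
step is less than `T`. -/
def record (hn : n = m + m) (h : Bits n → Bits m) (T : ℕ) (β : VCWire κ m n N s t a → Bool) :
    RecordWire n m N s → Bool :=
  Sum.elim (fun i => β (.com i)) (Sum.elim (fun j => β (.used j))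
    (Sum.elim (fun p => β (.pos p.1 p.2)) fun q =>
      decide (step N q.1.1 q.1.2 < T) && maskedPreimage hn h β q.1.1 q.1.2 q.2))

theorem record_eq_iff {hn : n = m + m} {h : Bits n → Bits m} {T : ℕ}
    {β β' : VCWire κ m n N s t a → Bool} :
    record hn h T β = record hn h T β' ↔ ((∀ i, β (.com i) = β' (.com i)) ∧
      (∀ j, β (.used j) = β' (.used j)) ∧ (∀ j i, β (.pos j i) = β' (.pos j i)) ∧
      ∀ (j : Fin s) k, k ≤ Nat.clog 2 N → step N j k < T →
        maskedPreimage hn h β j k = maskedPreimage hn h β' j k) := by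
  constructor
  · intro he
    refine ⟨fun i => congrFun he (.inl i), fun j => congrFun he (.inr (.inl j)),
      fun j i => congrFun he (.inr (.inr (.inl (j, i)))), fun j k hk hT => funext fun e => ?_⟩
    have := congrFun he (.inr (.inr (.inr ((j, ⟨k, Nat.lt_succ_of_le hk⟩), e))))
    simpa [record, hT] using this
  · rintro ⟨hc, hu, hp, hx⟩
    funext w
    rcases w with i | j | ⟨j, i⟩ | ⟨⟨j, k⟩, e⟩
    · exact hc i
    · exact hu j
    · exact hp j i
    · by_cases hT : step N j k < T
      · simp [record, hT, hx j k (Nat.le_of_lt_succ k.isLt) hT]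
      · simp [record, hT]

theorem record_succ_eq_iff {hn : n = m + m} {h : Bits n → Bits m} {j : Fin s} {k : ℕ}
    (hk : k ≤ Nat.clog 2 N) {β β' : VCWire κ m n N s t a → Bool} :
    record hn h (step N j k + 1) β = record hn h (step N j k + 1) β' ↔
      record hn h (step N j k) β = record hn h (step N j k) β' ∧
      maskedPreimage hn h β j k = maskedPreimage hn h β' j k := by
  rw [record_eq_iff, record_eq_iff]
  constructor
  · rintro ⟨hc, hu, hp, hx⟩
    exact ⟨⟨hc, hu, hp, fun j' k' hk' hT => hx j' k' hk' (hT.trans (Nat.lt_succ_self _))⟩,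
      hx j k hk (Nat.lt_succ_self _)⟩
  · rintro ⟨⟨hc, hu, hp, hx⟩, hjk⟩
    refine ⟨hc, hu, hp, fun j' k' hk' hT => ?_⟩
    rcases Nat.lt_succ_iff_lt_or_eq.1 hT with hT | hT
    · exact hx j' k' hk' hT
    · obtain ⟨h1, rfl⟩ := step_inj hk' hk hT
      rw [Fin.ext h1]
      exact hjk

/-- The hash of the next preimage to be measured is known: it is the commitment, or a part of the
preimage on the level above. -/
theorem hash_maskedPreimage_eq {hn : n = m + m} {h : Bits n → Bits m} {j : Fin s} {k : ℕ}
    (hk : k ≤ Nat.clog 2 N) {β β' : VCWire κ m n N s t a → Bool} (hβ : Accepted hn h β)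
    (hβ' : Accepted hn h β')
    (he : record hn h (step N j k) β = record hn h (step N j k) β') :
    h (maskedPreimage hn h β j k) = h (maskedPreimage hn h β' j k) := by
  obtain ⟨hc, hu, hp, hx⟩ := record_eq_iff.1 he
  cases hj : β (.used j)
  · rw [maskedPreimage_of_not_used hn h hj, maskedPreimage_of_not_used hn h ((hu j).symm.trans hj)]
  · have hj' := (hu j).symm.trans hj
    rw [maskedPreimage_of_used hn h hj, maskedPreimage_of_used hn h hj']
    rcases Nat.lt_or_eq_of_le hk with hlt | rfl
    · have := hx j (k + 1) hlt (by unfold step; omega)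
      rw [maskedPreimage_of_used hn h hj, maskedPreimage_of_used hn h hj'] at this
      refine (preimage_succ_inj ?_ this).1
      rw [positionBit, positionBit, dif_pos hlt, dif_pos hlt, hp]
    · rw [(hβ j).2 hj, (hβ' j).2 hj']
      exact funext hc

theorem pathEntry_eq_prfPart {β : VCWire κ m n N s t a → Bool} {Q : Finset (Fin N)}
    (hQ : Encodes (Nat.clog 2 N * m) β Q) {j : Fin s} (hj : j.val < Q.card)
    (k : Fin (Nat.clog 2 N)) (r : Fin m) :
    pathEntry β j k r =
      prfPart hQ.1.2 β (finProdFinEquiv (⟨j, hj⟩, finProdFinEquiv (k, r))) := by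
  have hlt : r.val + m * k.val + Nat.clog 2 N * m * j.val < t :=
    lt_of_lt_of_le (finProdFinEquiv ((⟨j, hj⟩ : Fin Q.card), finProdFinEquiv (k, r))).isLt hQ.1.2
  rw [pathEntry, dif_pos hlt]
  rfl

/-- Measuring all preimages amounts to measuring the symbols and the opening proof. -/
theorem opening_eq_iff {hn : n = m + m} {h : Bits n → Bits m}
    {β β' : VCWire κ m n N s t a → Bool} {Q : Finset (Fin N)}
    (hQ : Encodes (Nat.clog 2 N * m) β Q) (hQ' : Encodes (Nat.clog 2 N * m) β' Q) :
    (valPart Q hQ.1.1 β = valPart Q hQ.1.1 β' ∧ prfPart hQ.1.2 β = prfPart hQ.1.2 β') ↔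
      ∀ (j : Fin s) k, k ≤ Nat.clog 2 N →
        maskedPreimage hn h β j k = maskedPreimage hn h β' j k := by
  obtain ⟨hu, hp⟩ := hQ.2.congr hQ'.2
  constructor
  · rintro ⟨hv, hf⟩ j k hk
    cases hj : β (.used j)
    · rw [maskedPreimage_of_not_used hn h hj,
        maskedPreimage_of_not_used hn h ((hu j).symm.trans hj)]
    · rw [maskedPreimage_of_used hn h hj, maskedPreimage_of_used hn h ((hu j).symm.trans hj)]
      have hjQ := (hQ.2.used_iff j).1 hj
      induction k with
      | zero =>
        have := congrFun hv (Q.orderIsoOfFin rfl ⟨j, hjQ⟩)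
        unfold valPart at this
        rw [rank, OrderIso.symm_apply_apply] at this
        exact this
      | succ k ih =>
        have hk' : k < Nat.clog 2 N := hk
        have hpath : pathEntry β j k = pathEntry β' j k := by
          funext r
          rw [pathEntry_eq_prfPart hQ hjQ ⟨k, hk'⟩, pathEntry_eq_prfPart hQ' hjQ ⟨k, hk'⟩, hf]
        have hbit : positionBit β j k = positionBit β' j k := by
          rw [positionBit, positionBit, dif_pos hk', dif_pos hk', hp]
        rw [preimage, preimage, ih hk'.le, hpath, hbit]
  · intro hx
    have hpre : ∀ (j : Fin s), j.val < Q.card → ∀ k, k ≤ Nat.clog 2 N →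
        preimage hn h β j k = preimage hn h β' j k := by
      intro j hj k hk
      rw [← maskedPreimage_of_used hn h ((hQ.2.used_iff j).2 hj),
        ← maskedPreimage_of_used hn h ((hQ'.2.used_iff j).2 hj)]
      exact hx j k hk
    constructor
    · funext i e
      exact congrFun (hpre (Fin.castLE hQ.1.1 (rank Q i)) (rank Q i).isLt 0 (Nat.zero_le _)) e
    · funext w
      obtain ⟨⟨j, w⟩, rfl⟩ := finProdFinEquiv.surjective w
      obtain ⟨⟨k, r⟩, rfl⟩ := finProdFinEquiv.surjective w
      have := (preimage_succ_inj (β := β) (β' := β')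
        (by rw [positionBit, positionBit, dif_pos k.isLt, dif_pos k.isLt, hp])
        (hpre (Fin.castLE hQ.1.1 j) j.isLt (k.val + 1) k.isLt)).2
      have h2 := congrFun this r
      rwa [pathEntry_eq_prfPart hQ (j := Fin.castLE hQ.1.1 j) j.isLt,
        pathEntry_eq_prfPart hQ' (j := Fin.castLE hQ.1.1 j) j.isLt] at h2

theorem accepted_and_query_iff {hn : n = m + m} {h : Bits n → Bits m}
    {β : VCWire κ m n N s t a → Bool} {Q : Finset (Fin N)}
    (hQ : Q.card ≤ s ∧ Q.card * (Nat.clog 2 N * m) ≤ t) (cm : Bits m) :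
    (((fun i => β (.com i)) = cm ∧ HoldsQuery Q β) ∧
      decide (∀ i : Q, pathRoot hn h i.val.val (valPart Q hQ.1 β i) (Nat.clog 2 N)
        (fun k r => prfPart hQ.2 β (finProdFinEquiv (rank Q i, finProdFinEquiv (k, r)))) = cm) =
          true) ↔
      Accepted hn h β ∧ ((fun i => β (.com i) : Bits m), query β) = (cm, Q) := by
  rw [decide_eq_true_iff, Prod.mk.injEq]
  constructor
  · rintro ⟨⟨hc, hq⟩, hv⟩
    rw [verify_iff hn h (β := β) ⟨hQ, hq⟩] at hv
    exact ⟨accepted_iff.2 ⟨Q, ⟨hQ, hq⟩, hc ▸ hv⟩, hc, query_eq ⟨hQ, hq⟩⟩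
  · rintro ⟨ha, hc, hq⟩
    have hE := ha.encodes
    rw [hq] at hE
    refine ⟨⟨hc, hE.2⟩, (verify_iff hn h hE cm).2 fun j hj => ?_⟩
    rw [(ha j).2 hj, hc]

theorem merkleExp_false (hn : n = m + m) (ev : Bits κ → Bits n → Bits m)
    (A : VCAdversary κ m n N) (k : Bits κ) :
    merkleExp hn ev A k false = measuredProb A.second A.answer (Accepted hn (ev k))
      (record hn (ev k) 0) (A.first.run (ket (vcInit k))) := by
  have h1 : merkleExp hn ev A k false = measuredProb A.second A.answer (Accepted hn (ev k))
      (fun β => ((fun i => β (.com i) : Bits m), query β)) (A.first.run (ket (vcInit k))) := by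
    rw [merkleExp, measuredProb, Fintype.sum_prod_type]
    refine Finset.sum_congr rfl fun cm _ => Finset.sum_congr rfl fun Q _ => ?_
    by_cases h : Q.card ≤ A.slots ∧ Q.card * (Nat.clog 2 N * m) ≤ A.proofCap
    · rw [dif_pos h]
      simp only [Bool.false_eq_true, if_false]
      rw [proj_proj]
      congr 1
      exact proj_congr (fun β => accepted_and_query_iff h cm) _
    · rw [dif_neg h, proj_eq_zero, acceptProb_zero]
      rintro β ⟨ha, he⟩
      rw [Prod.mk.injEq] at he
      exact h (he.2 ▸ ha.encodes.1)
  rw [h1]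
  refine measuredProb_congr _ _ _ fun β β' hβ hβ' => ?_
  rw [Prod.mk.injEq, record_eq_iff]
  constructor
  · rintro ⟨hc, hq⟩
    have hQ := hβ.encodes
    rw [hq] at hQ
    obtain ⟨hu, hp⟩ := hQ.2.congr hβ'.encodes.2
    exact ⟨congrFun hc, hu, hp, fun _ _ _ h => absurd h (Nat.not_lt_zero _)⟩
  · rintro ⟨hc, hu, hp, -⟩
    exact ⟨funext hc, hβ.encodes.unique hβ'.encodes hu hp⟩

theorem merkleExp_true (hn : n = m + m) (ev : Bits κ → Bits n → Bits m)
    (A : VCAdversary κ m n N) (k : Bits κ) :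
    merkleExp hn ev A k true = measuredProb A.second A.answer (Accepted hn (ev k))
      (record hn (ev k) ((Nat.clog 2 N + 1) * A.slots)) (A.first.run (ket (vcInit k))) := by
  -- all the preimages of all slots
  let full : (VCWire κ m n N A.slots A.proofCap A.work → Bool) →
      Fin A.slots × Fin (Nat.clog 2 N + 1) → Bits n :=
    fun β p => maskedPreimage hn (ev k) β p.1 p.2
  have hfull : ∀ β β', full β = full β' ↔ ∀ (j : Fin A.slots) i, i ≤ Nat.clog 2 N →
      maskedPreimage hn (ev k) β j i = maskedPreimage hn (ev k) β' j i := by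
    intro β β'
    exact ⟨fun h j i hi => congrFun h (j, ⟨i, Nat.lt_succ_of_le hi⟩),
      fun h => funext fun p => h p.1 p.2 (Nat.le_of_lt_succ p.2.isLt)⟩
  have h1 : merkleExp hn ev A k true = measuredProb A.second A.answer (Accepted hn (ev k))
      (fun β => (((fun i => β (.com i) : Bits m), query β), full β))
      (A.first.run (ket (vcInit k))) := by
    rw [merkleExp, measuredProb_prod, Fintype.sum_prod_type]
    refine Finset.sum_congr rfl fun cm _ => Finset.sum_congr rfl fun Q _ => ?_
    by_cases h : Q.card ≤ A.slots ∧ Q.card * (Nat.clog 2 N * m) ≤ A.proofCap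
    · rw [dif_pos h]
      simp only [if_true]
      rw [← Fintype.sum_prod_type']
      have : ∀ vp : (Q → Bits n) × Bits (Q.card * (Nat.clog 2 N * m)),
          acceptProb A.second A.answer
            (proj (fun β => valPart Q h.1 β = vp.1 ∧ prfPart h.2 β = vp.2)
              (proj (fun β => decide (∀ i : Q,
                pathRoot hn (ev k) i.val (valPart Q h.1 β i) (Nat.clog 2 N)
                (fun k r => prfPart h.2 β
                  (finProdFinEquiv (rank Q i, finProdFinEquiv (k, r)))) = cm) = true)
                (proj (fun β => (fun i => β (.com i)) = cm ∧ HoldsQuery Q β)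
                  (A.first.run (ket (vcInit k)))))) =
          acceptProb A.second A.answer
            (proj (fun β => (Accepted hn (ev k) β ∧
              ((fun i => β (.com i) : Bits m), query β) = (cm, Q)) ∧
              (valPart Q h.1 β, prfPart h.2 β) = vp) (A.first.run (ket (vcInit k)))) := by
        intro vp
        rw [proj_proj, proj_proj]
        congr 1
        refine proj_congr (fun β => ?_) _
        rw [← and_assoc]
        exact and_congr (accepted_and_query_iff h cm) (by rw [Prod.ext_iff])
      rw [Finset.sum_congr rfl fun vp _ => this vp]
      refine measuredProb_congr A.second A.answer (P := fun β => Accepted hn (ev k) β ∧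
        ((fun i => β (.com i) : Bits m), query β) = (cm, Q))
        (R := fun β => (valPart Q h.1 β, prfPart h.2 β)) (R' := full) _ ?_
      rintro β β' ⟨hβ, he⟩ ⟨hβ', he'⟩
      rw [Prod.mk.injEq] at he he'
      have hQ := hβ.encodes
      have hQ' := hβ'.encodes
      rw [he.2] at hQ
      rw [he'.2] at hQ'
      rw [hfull, Prod.mk.injEq]
      exact opening_eq_iff hQ hQ'
    · rw [dif_neg h, measuredProb]
      refine (Finset.sum_eq_zero fun x _ => ?_).symm
      rw [proj_eq_zero, acceptProb_zero]
      rintro β ⟨⟨ha, he⟩, -⟩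
      rw [Prod.mk.injEq] at he
      exact h (he.2 ▸ ha.encodes.1)
  rw [h1]
  refine measuredProb_congr _ _ _ fun β β' hβ hβ' => ?_
  rw [Prod.mk.injEq, Prod.mk.injEq, record_eq_iff, hfull]
  constructor
  · rintro ⟨⟨hc, hq⟩, hx⟩
    have hQ := hβ.encodes
    rw [hq] at hQ
    obtain ⟨hu, hp⟩ := hQ.2.congr hβ'.encodes.2
    exact ⟨congrFun hc, hu, hp, fun j i hi _ => hx j i hi⟩
  · rintro ⟨hc, hu, hp, hx⟩
    exact ⟨⟨funext hc, hβ.encodes.unique hβ'.encodes hu hp⟩,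
      fun j i hi => hx j i hi (step_lt j.isLt)⟩

end Hybrids

/-! ### Circuits for Merkle trees -/

section Basic

variable {V : Type} [Fintype V] [DecidableEq V]

theorem HasCircuit.bit_congr {f g : (V → Bool) → Bool} {p q : ℕ} (h : HasBitCircuit f p)
    (hfg : ∀ b, g b = f b) (hpq : p ≤ q) : HasBitCircuit g q := by
  rw [show g = f from funext hfg]
  exact h.mono hpq

theorem HasCircuit.mux {c x y : (V → Bool) → Bool} {p q r : ℕ} (hc : HasBitCircuit c p)
    (hx : HasBitCircuit x q) (hy : HasBitCircuit y r) :
    HasBitCircuit (fun b => if c b then x b else y b) (2 * p + q + r + 25) := by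
  refine (HasCircuit.op (fun u v => u || v) (HasCircuit.op (fun u v => u && v) hc hx)
    (HasCircuit.op (fun u v => u && v) hc.not hy)).bit_congr (fun b => ?_) (by omega)
  cases c b <;> simp

/-- Comparison of binary numbers, from the least significant bit on: `c` is the result for the bits
that have been dealt with. -/
theorem hasBitCircuit_ofBits_lt {d : ℕ} {f g : (V → Bool) → Fin d → Bool}
    {c : (V → Bool) → Bool} {p : ℕ} (hf : ∀ i, HasBitCircuit (fun b => f b i) 1)
    (hg : ∀ i, HasBitCircuit (fun b => g b i) 1) (hc : HasBitCircuit c p) :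
    HasBitCircuit (fun b => decide (Nat.ofBits (f b) < Nat.ofBits (g b) + (c b).toNat))
      (p + d * 28) := by
  induction d generalizing c p with
  | zero =>
    refine hc.bit_congr (fun b => ?_) (Nat.le_add_right _ _)
    cases c b <;> simp
  | succ d ih =>
    have h0 := HasCircuit.op (fun u v => u || v) (HasCircuit.op (fun u v => !u && v) (hf 0) (hg 0))
      (HasCircuit.op (fun u v => u && v) (HasCircuit.op (fun u v => !(xor u v)) (hf 0) (hg 0)) hc)
    refine (ih (fun i => hf i.succ) (fun i => hg i.succ) h0).bit_congr (fun b => ?_) (by omega)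
    rw [Nat.ofBits_succ, Nat.ofBits_succ, decide_eq_decide]
    change 2 * Nat.ofBits (fun i : Fin d => f b i.succ) + _ <
      2 * Nat.ofBits (fun i : Fin d => g b i.succ) + _ + _ ↔ _
    generalize Nat.ofBits (fun i : Fin d => f b i.succ) = u
    generalize Nat.ofBits (fun i : Fin d => g b i.succ) = v
    cases f b 0 <;> cases g b 0 <;> cases c b <;> simp <;> omega

theorem hasBitCircuit_eq (m : ℕ) :
    HasBitCircuit (fun b : Fin m ⊕ Fin m → Bool => decide (b ∘ Sum.inl = b ∘ Sum.inr))
      (m * 14 + 1) := by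
  refine (hasBitCircuit_forall (V := Fin m ⊕ Fin m)
    (f := fun i b => !(xor (b (Sum.inl i)) (b (Sum.inr i))))
    (fun i => HasCircuit.op (fun u v => !(xor u v)) (hasBitCircuit_var (Sum.inl i))
      (hasBitCircuit_var (Sum.inr i)))).bit_congr (fun b => ?_) le_rfl
  rw [decide_eq_decide, funext_iff]
  simp

end Basic

section Merkle

variable {κ n m N s t a hc S : ℕ}

/-- The sizes of all the parameters are bounded by `S`, where `hc` is the size of a circuit for the
hash function, and `s` is the number of slots. The bounds below are generous, so that they can be
stated as multiples of powers of `S`. -/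
structure SizeBound (κ n m N s hc S : ℕ) : Prop where
  one_le : 1 ≤ S
  key_le : κ ≤ S
  inp_le : n ≤ S
  out_le : m ≤ S
  hash_le : hc ≤ S
  slots_le : s * (Nat.clog 2 N + 1) ≤ S

theorem SizeBound.clog_lt (h : SizeBound κ n m N s hc S) (j : Fin s) : Nat.clog 2 N + 1 ≤ S :=
  (Nat.le_mul_of_pos_left _ (Nat.zero_lt_of_lt j.isLt)).trans h.slots_le

theorem SizeBound.le_slots (h : SizeBound κ n m N s hc S) : s ≤ S :=
  (Nat.le_mul_of_pos_right _ (Nat.succ_pos _)).trans h.slots_le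

theorem HasCircuit.hash {V : Type} [Fintype V] [DecidableEq V] {ev : Bits κ → Bits n → Bits m}
    {f : (Fin κ ⊕ V → Bool) → Bits n} {p : ℕ} (hf : HasCircuit f p)
    (hev : HasCircuit (fun b : Fin κ ⊕ Fin n → Bool => ev (b ∘ Sum.inl) (b ∘ Sum.inr)) hc) :
    HasCircuit (fun b => ev (b ∘ Sum.inl) (f b)) (p + hc + 2 * κ + n) := by
  refine (((hasCircuit_proj (V := Fin κ ⊕ V) Sum.inl).pair hf).comp hev).mono ?_
  simp only [Fintype.card_sum, Fintype.card_fin]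
  omega

/-- A node, a bit of the position and the sibling (in the order of the summands) are arranged into a
hash input. -/
theorem hasCircuit_select (hn : n = m + m) :
    HasCircuit (fun (w : Fin m ⊕ (Unit ⊕ Fin m) → Bool) (e : Fin n) =>
      if w (.inr (.inl ())) then
        Fin.append (fun r => w (.inr (.inr r))) (fun r => w (.inl r)) (Fin.cast hn e)
      else Fin.append (fun r => w (.inl r)) (fun r => w (.inr (.inr r))) (Fin.cast hn e))
      (n * 31) := by
  have hvar : ∀ (x y : Fin m → Fin m ⊕ (Unit ⊕ Fin m)) (e : Fin (m + m)),
      HasBitCircuit (fun w : Fin m ⊕ (Unit ⊕ Fin m) → Bool =>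
        Fin.append (fun r => w (x r)) (fun r => w (y r)) e) 1 := by
    intro x y e
    refine Fin.addCases (fun i => ?_) (fun i => ?_) e
    · simp only [Fin.append_left]
      exact hasBitCircuit_var _
    · simp only [Fin.append_right]
      exact hasBitCircuit_var _
  refine (hasCircuit_pi fun e => HasCircuit.mux (hasBitCircuit_var _) (hvar _ _ _)
    (hvar _ _ _)).mono ?_
  simp

theorem hasCircuit_preimage (hn : n = m + m) {ev : Bits κ → Bits n → Bits m}
    (hev : HasCircuit (fun b : Fin κ ⊕ Fin n → Bool => ev (b ∘ Sum.inl) (b ∘ Sum.inr)) hc)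
    (j : Fin s) (k : ℕ) :
    HasCircuit (fun b : Fin κ ⊕ VCWire κ m n N s t a → Bool =>
      preimage hn (ev (b ∘ Sum.inl)) (b ∘ Sum.inr) j k)
      (n + k * (hc + 2 * κ + 32 * n + 5 * m + 2)) := by
  induction k with
  | zero =>
    refine (hasCircuit_proj fun e : Fin n => Sum.inr (VCWire.val j e)).mono ?_
    simp
  | succ k ih =>
    have hbit : HasBitCircuit (fun b : Fin κ ⊕ VCWire κ m n N s t a → Bool =>
        positionBit (b ∘ Sum.inr) j k) 1 := by
      unfold positionBit
      split_ifs
      · exact hasBitCircuit_var _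
      · exact hasBitCircuit_const _
    have hpath : HasCircuit (fun b : Fin κ ⊕ VCWire κ m n N s t a → Bool =>
        pathEntry (b ∘ Sum.inr) j k) (Fintype.card (Fin m) * (1 + 2)) := by
      refine hasCircuit_pi fun r => ?_
      unfold pathEntry
      split_ifs
      · exact hasBitCircuit_var _
      · exact hasBitCircuit_const _
    refine (((ih.hash hev).pair (hbit.pair hpath)).comp (hasCircuit_select hn)).mono ?_
    simp only [Fintype.card_sum, Fintype.card_fin, Fintype.card_unit]
    exact le_of_eq (by ring)

theorem SizeBound.preimage_le (h : SizeBound κ n m N s hc S) (j : Fin s) {k : ℕ}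
    (hk : k ≤ Nat.clog 2 N) :
    n + k * (hc + 2 * κ + 32 * n + 5 * m + 2) ≤ 43 * S ^ 2 := by
  have h1 : k * (hc + 2 * κ + 32 * n + 5 * m + 2) ≤ S * (42 * S) := by
    have := h.clog_lt j
    have := h.one_le
    have := h.key_le
    have := h.inp_le
    have := h.out_le
    have := h.hash_le
    exact Nat.mul_le_mul (by omega) (by omega)
  have h2 : n ≤ S * S := h.inp_le.trans (Nat.le_mul_self S)
  calc _ ≤ S * S + S * (42 * S) := add_le_add h2 h1
    _ = _ := by ring

theorem hasCircuit_maskedPreimage (hn : n = m + m) {ev : Bits κ → Bits n → Bits m}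
    (hev : HasCircuit (fun b : Fin κ ⊕ Fin n → Bool => ev (b ∘ Sum.inl) (b ∘ Sum.inr)) hc)
    (hS : SizeBound κ n m N s hc S) (j : Fin s) {k : ℕ} (hk : k ≤ Nat.clog 2 N) :
    HasCircuit (fun b : Fin κ ⊕ VCWire κ m n N s t a → Bool =>
      maskedPreimage hn (ev (b ∘ Sum.inl)) (b ∘ Sum.inr) j k) (56 * S ^ 2) := by
  have hand : HasCircuit (fun (w : Unit ⊕ Fin n → Bool) (e : Fin n) => w (.inl ()) && w (.inr e))
      (Fintype.card (Fin n) * (1 + 1 + 6 + 2)) :=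
    hasCircuit_pi fun e => HasCircuit.op (fun u v => u && v) (hasBitCircuit_var _)
      (hasBitCircuit_var _)
  refine (((hasBitCircuit_var (V := Fin κ ⊕ VCWire κ m n N s t a) (.inr (.used j))).pair
    (hasCircuit_preimage hn hev j k)).comp hand).mono ?_
  have h1 := hS.preimage_le j hk
  have h2 := hS.inp_le
  have h3 := hS.one_le
  have h4 : S ≤ S ^ 2 := Nat.le_self_pow two_ne_zero S
  simp only [Fintype.card_sum, Fintype.card_fin, Fintype.card_unit]
  omega

theorem hasBitCircuit_wellFormedAt (r : ℕ) (j : Fin s)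
    [∀ β : VCWire κ m n N s t a → Bool, Decidable (WellFormedAt r β j)] :
    HasBitCircuit (fun b : Fin κ ⊕ VCWire κ m n N s t a → Bool =>
      decide (WellFormedAt r (b ∘ Sum.inr) j)) (70 * Nat.clog 2 N + 50) := by
  classical
  let I := Fin κ ⊕ VCWire κ m n N s t a
  have hpos : ∀ (j : Fin s) i, HasBitCircuit (fun b : I → Bool => b (.inr (.pos j i))) 1 :=
    fun j i => hasBitCircuit_var _
  have hused : ∀ j : Fin s, HasBitCircuit (fun b : I → Bool => b (.inr (.used j))) 1 :=
    fun j => hasBitCircuit_var _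
  have h1 : HasBitCircuit (fun b : I → Bool => decide (position (b ∘ Sum.inr) j < N))
      (1 + Nat.clog 2 N * 28) := by
    rcases Nat.eq_zero_or_pos N with rfl | hN
    · refine HasCircuit.mono ?_ (Nat.le_add_right _ _)
      simpa using hasBitCircuit_const (V := I) false
    · -- `position < (N - 1) + 1`, where `N - 1` has at most `Nat.clog 2 N` bits
      refine (hasBitCircuit_ofBits_lt (V := I) (f := fun b i => b (.inr (.pos j i)))
        (g := fun _ (i : Fin (Nat.clog 2 N)) => (N - 1).testBit i) (c := fun _ => true) (hpos j)
        (fun i => hasBitCircuit_const _) (hasBitCircuit_const _)).bit_congr (fun b => ?_) le_rfl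
      have hlt : N - 1 < 2 ^ Nat.clog 2 N :=
        lt_of_lt_of_le (by omega) (Nat.le_pow_clog one_lt_two N)
      rw [Nat.ofBits_testBit, Nat.mod_eq_of_lt hlt, Bool.toNat_true, Nat.sub_add_cancel hN]
      rfl
  have h2 := HasCircuit.op (fun u v => !u || v) (hused j)
    (HasCircuit.op (fun u v => u && v) h1
      (hasBitCircuit_const (V := I) (decide ((j.val + 1) * r ≤ t))))
  have h3 := HasCircuit.op (fun u v => u || v) (hused j)
    (hasBitCircuit_forall (V := I) fun i => (hpos j i).not)
  have h4 : HasBitCircuit (fun b : I → Bool => decide (∀ h : j.val + 1 < s,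
      b (.inr (.used ⟨j.val + 1, h⟩)) = true →
      b (.inr (.used j)) = true ∧
        position (b ∘ Sum.inr) j < position (b ∘ Sum.inr) ⟨j.val + 1, h⟩))
      (1 + (1 + (1 + Nat.clog 2 N * 28) + 6) + 6) := by
    by_cases h : j.val + 1 < s
    · have h5 := hasBitCircuit_ofBits_lt (V := I) (f := fun b i => b (.inr (.pos j i)))
        (g := fun b i => b (.inr (.pos ⟨j.val + 1, h⟩ i))) (hpos _) (hpos _)
        (hasBitCircuit_const false)
      refine (HasCircuit.op (fun u v => !u || v) (hused ⟨j.val + 1, h⟩)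
        (HasCircuit.op (fun u v => u && v) (hused j) h5)).bit_congr (fun b => ?_) le_rfl
      rw [Bool.eq_iff_iff, decide_eq_true_iff, forall_prop_of_true h]
      cases b (.inr (.used ⟨j.val + 1, h⟩)) <;>
        simp [position]
    · refine HasCircuit.mono ?_ (show 1 ≤ _ by omega)
      simpa [h] using hasBitCircuit_const (V := I) true
  refine (HasCircuit.op (fun u v => u && v) h2 (HasCircuit.op (fun u v => u && v) h3
    h4)).bit_congr (fun b => ?_) ?_
  · rw [Bool.eq_iff_iff, decide_eq_true_iff]
    simp only [WellFormedAt, decide_eq_true_eq, Bool.or_eq_true, Bool.not_eq_true',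
        Bool.and_eq_true, Function.comp_apply]
    refine and_congr ?_ (and_congr ?_ Iff.rfl) <;> cases b (.inr (.used j)) <;> simp
  · omega

theorem hasBitCircuit_accepted (hn : n = m + m) {ev : Bits κ → Bits n → Bits m}
    (hev : HasCircuit (fun b : Fin κ ⊕ Fin n → Bool => ev (b ∘ Sum.inl) (b ∘ Sum.inr)) hc)
    (hS : SizeBound κ n m N s hc S)
    [∀ (h : Bits n → Bits m) (β : VCWire κ m n N s t a → Bool), Decidable (Accepted hn h β)] :
    HasBitCircuit (fun b : Fin κ ⊕ VCWire κ m n N s t a → Bool =>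
      decide (Accepted hn (ev (b ∘ Sum.inl)) (b ∘ Sum.inr))) (210 * S ^ 3) := by
  classical
  let I := Fin κ ⊕ VCWire κ m n N s t a
  have key : ∀ j : Fin s, HasBitCircuit (fun b : I → Bool =>
      decide (WellFormedAt (Nat.clog 2 N * m) (b ∘ Sum.inr) j ∧ (b (.inr (.used j)) = true →
        ev (b ∘ Sum.inl) (preimage hn (ev (b ∘ Sum.inl)) (b ∘ Sum.inr) j (Nat.clog 2 N)) =
          fun i => b (.inr (.com i))))) (198 * S ^ 2) := by
    intro j
    have h1 := (((hasCircuit_preimage (N := N) (t := t) (a := a) hn hev j (Nat.clog 2 N)).hash hev).pair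
      (hasCircuit_proj fun i : Fin m => Sum.inr (VCWire.com i))).comp (hasBitCircuit_eq m)
    have h2 := HasCircuit.op (fun u v => u && v)
      (hasBitCircuit_wellFormedAt (κ := κ) (Nat.clog 2 N * m) j)
      (HasCircuit.op (fun u v => !u || v) (hasBitCircuit_var (.inr (.used j))) h1)
    refine h2.bit_congr (fun b => ?_) ?_
    · rw [Bool.eq_iff_iff, decide_eq_true_iff, Bool.and_eq_true, decide_eq_true_iff]
      refine and_congr Iff.rfl ?_
      cases b (.inr (.used j))
      · simp
      · simp only [forall_true_left, Bool.not_true, Bool.false_or, Sum.elim_comp_inl,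
          Sum.elim_comp_inr]
        exact decide_eq_true_iff.symm
    · have h3 := hS.preimage_le j le_rfl
      have := hS.clog_lt j
      have := hS.one_le
      have := hS.key_le
      have := hS.inp_le
      have := hS.out_le
      have := hS.hash_le
      have h4 : S ≤ S ^ 2 := Nat.le_self_pow two_ne_zero S
      simp only [Fintype.card_sum, Fintype.card_fin]
      omega
  refine (hasBitCircuit_forall key).bit_congr (fun b => ?_) ?_
  · rw [decide_eq_decide]
    simp only [decide_eq_true_eq]
    rfl
  · have h1 : s * (198 * S ^ 2 + 6) ≤ S * (198 * S ^ 2 + 6) :=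
      Nat.mul_le_mul_right _ hS.le_slots
    have h2 : S * (198 * S ^ 2 + 6) = 198 * S ^ 3 + 6 * S := by ring
    have h3 : S ≤ S ^ 3 := Nat.le_self_pow three_ne_zero S
    have := hS.one_le
    omega

theorem SizeBound.card_recordWire_le (h : SizeBound κ n m N s hc S) :
    Fintype.card (RecordWire n m N s) ≤ 4 * S ^ 2 := by
  have h1 : s * (Nat.clog 2 N + 1) * n ≤ S * S := Nat.mul_le_mul h.slots_le h.inp_le
  have h2 : s * Nat.clog 2 N ≤ S := (Nat.mul_le_mul_left s (Nat.le_succ _)).trans h.slots_le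
  have h3 : S ≤ S ^ 2 := Nat.le_self_pow two_ne_zero S
  have h4 := h.le_slots
  have h5 := h.out_le
  have h6 : S ^ 2 = S * S := sq S
  simp only [Fintype.card_sum, Fintype.card_fin, Fintype.card_prod]
  omega

theorem hasCircuit_record (hn : n = m + m) {ev : Bits κ → Bits n → Bits m}
    (hev : HasCircuit (fun b : Fin κ ⊕ Fin n → Bool => ev (b ∘ Sum.inl) (b ∘ Sum.inr)) hc)
    (hS : SizeBound κ n m N s hc S) (T : ℕ) :
    HasCircuit (fun b : Fin κ ⊕ VCWire κ m n N s t a → Bool =>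
      record hn (ev (b ∘ Sum.inl)) T (b ∘ Sum.inr)) (59 * S ^ 3) := by
  let I := Fin κ ⊕ VCWire κ m n N s t a
  have hx : ∀ p : Fin s × Fin (Nat.clog 2 N + 1), HasCircuit (fun (b : I → Bool) (e : Fin n) =>
      decide (step N p.1 p.2 < T) &&
        maskedPreimage hn (ev (b ∘ Sum.inl)) (b ∘ Sum.inr) p.1 p.2 e) (56 * S ^ 2) := by
    rintro ⟨j, k⟩
    by_cases hT : step N j k < T
    · simp only [hT, decide_true, Bool.true_and]
      exact hasCircuit_maskedPreimage hn hev hS j (Nat.le_of_lt_succ k.isLt)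
    · simp only [hT, decide_false, Bool.false_and]
      refine (hasCircuit_pi fun e => hasBitCircuit_const _).mono ?_
      have h1 : S ≤ S ^ 2 := Nat.le_self_pow two_ne_zero S
      have h2 := hS.inp_le
      rw [Fintype.card_fin]
      omega
  refine HasCircuit.mono ((hasCircuit_proj (V := I) fun i : Fin m => Sum.inr (VCWire.com i)).pair
    ((hasCircuit_proj (V := I) fun j : Fin s => Sum.inr (VCWire.used j)).pair
    ((hasCircuit_proj (V := I) fun p : Fin s × Fin (Nat.clog 2 N) => Sum.inr (VCWire.pos p.1 p.2)).pair
    (hasCircuit_family hx)))) ?_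
  have h1 : s * (Nat.clog 2 N + 1) * (56 * S ^ 2) ≤ S * (56 * S ^ 2) :=
    Nat.mul_le_mul_right _ hS.slots_le
  have h2 : s * Nat.clog 2 N ≤ S := (Nat.mul_le_mul_left s (Nat.le_succ _)).trans hS.slots_le
  have h3 : S ≤ S ^ 3 := Nat.le_self_pow three_ne_zero S
  have h4 := hS.le_slots
  have h5 := hS.out_le
  have h6 : S * (56 * S ^ 2) = 56 * S ^ 3 := by ring
  simp only [Fintype.card_prod, Fintype.card_fin]
  omega

end Merkle

/-! ### The hybrid argument -/

section Hybrids

variable {κ n m N s t a w hc S : ℕ}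

/-- The wires of a circuit for the hash function, as inputs, outputs and ancillas. -/
def hashCircuitWire : HashWire κ n m w → ((Fin κ ⊕ Fin n) ⊕ Fin m) ⊕ Fin w
  | .key i => .inl (.inl (.inl i))
  | .inp i => .inl (.inl (.inr i))
  | .out i => .inl (.inr i)
  | .work i => .inr i

theorem hashCircuitWire_injective :
    Function.Injective (hashCircuitWire (κ := κ) (n := n) (m := m) (w := w)) := by
  rintro (i | i | i | i) (j | j | j | j) h <;> simp_all [hashCircuitWire]

theorem hasCircuit_of_hashInit {ev : Bits κ → Bits n → Bits m} (C : Circuit (HashWire κ n m w))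
    (hC : ∀ k x y, C.run (ket (hashInit k x y)) =
      ket (hashInit k x fun i => xor (y i) (ev k x i))) :
    HasCircuit (fun b : Fin κ ⊕ Fin n → Bool => ev (b ∘ Sum.inl) (b ∘ Sum.inr))
      (C.length + w) := by
  refine HasCleanCircuit.hasCircuit ⟨Fin w, inferInstance, inferInstance,
    Circuit.map ⟨hashCircuitWire, hashCircuitWire_injective⟩ C, ?_, fun b z => ?_⟩
  · rw [Circuit.length_map, Fintype.card_fin]
  · have h : Maps C _ _ := hC (b ∘ Sum.inl) (b ∘ Sum.inr) z
    refine h.map _ (by rintro (i | i | i | i) <;> rfl) (by rintro (i | i | i | i) <;> rfl) ?_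
    rintro (((i | i) | i) | i) hw
    · exact absurd rfl (hw (.key i))
    · exact absurd rfl (hw (.inp i))
    · exact absurd rfl (hw (.out i))
    · exact absurd rfl (hw (.work i))

set_option synthInstance.maxSize 1000 in
theorem card_vcWire_le :
    Fintype.card (VCWire κ m n N s t a) ≤ κ + m + s * (1 + Nat.clog 2 N + n) + t + a := by
  let f : VCWire κ m n N s t a →
      Fin κ ⊕ (Fin m ⊕ ((Fin s × (Unit ⊕ (Fin (Nat.clog 2 N) ⊕ Fin n))) ⊕ (Fin t ⊕ Fin a)))
    | .key i => .inl i
    | .com i => .inr (.inl i)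
    | .used j => .inr (.inr (.inl (j, .inl ())))
    | .pos j i => .inr (.inr (.inl (j, .inr (.inl i))))
    | .val j i => .inr (.inr (.inl (j, .inr (.inr i))))
    | .prf i => .inr (.inr (.inr (.inl i)))
    | .work i => .inr (.inr (.inr (.inr i)))
  have hf : Function.Injective f := by
    intro x y h
    cases x <;> cases y <;> simp_all [f]
  refine (Fintype.card_le_of_injective f hf).trans (le_of_eq ?_)
  simp only [Fintype.card_sum, Fintype.card_prod, Fintype.card_fin, Fintype.card_unit]
  ring

/-- Consecutive hybrids are the two experiments of some adversary against the hash function. -/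
theorem exists_hashAdversary_step (hn : n = m + m) {ev : Bits κ → Bits n → Bits m}
    (hev : HasCircuit (fun b : Fin κ ⊕ Fin n → Bool => ev (b ∘ Sum.inl) (b ∘ Sum.inr)) hc)
    (A : VCAdversary κ m n N) (hS : SizeBound κ n m N A.slots hc S) (hA : A.size ≤ S)
    (j : Fin A.slots) {k : ℕ} (hk : k ≤ Nat.clog 2 N) :
    ∃ B : HashAdversary κ n m, B.size ≤ 3600 * S ^ 3 ∧
      (∀ x, hashExp ev B x false = measuredProb A.second A.answer (Accepted hn (ev x))
        (record hn (ev x) (step N j k)) (A.first.run (ket (vcInit x)))) ∧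
      ∀ x, hashExp ev B x true = measuredProb A.second A.answer (Accepted hn (ev x))
        (record hn (ev x) (step N j k + 1)) (A.first.run (ket (vcInit x))) := by
  classical
  have hX := hasCircuit_maskedPreimage (t := A.proofCap) (a := A.work) hn hev hS j hk
  have hR := hasCircuit_record (t := A.proofCap) (a := A.work) hn hev hS (step N j k)
  have hV := hasBitCircuit_accepted (t := A.proofCap) (a := A.work) hn hev hS
  obtain ⟨B, hB, h₀, h₁⟩ := exists_hashAdversary ev
    (VCWire.key : Fin κ → VCWire κ m n N A.slots A.proofCap A.work)
    (fun i j h => by simpa using h) vcInit (fun _ _ => rfl)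
    (fun k v hv => by
      cases v with
      | key i => exact absurd rfl (hv i)
      | _ => rfl)
    A.first A.second A.answer _ _ _
    (hX.pair ((hX.hash hev).pair (hR.pair hV))).hasCleanCircuit hX.hasCleanCircuit
    (fun x b b' hb hb' he => by
      rw [decide_eq_true_iff] at hb hb'
      exact hash_maskedPreimage_eq hk hb hb' he)
  refine ⟨B, hB.trans ?_, fun x => ?_, fun x => ?_⟩
  · have h1 := hS.card_recordWire_le
    have h2 := card_vcWire_le (κ := κ) (m := m) (n := n) (N := N) (s := A.slots) (t := A.proofCap)
      (a := A.work)
    have := hS.one_le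
    have := hS.key_le
    have := hS.inp_le
    have := hS.out_le
    have := hS.hash_le
    have h3 : S ≤ S ^ 2 := Nat.le_self_pow two_ne_zero S
    have h4 : S ^ 2 ≤ S ^ 3 := Nat.pow_le_pow_right hS.one_le (by norm_num)
    rw [VCAdversary.size] at hA
    simp only [Fintype.card_sum, Fintype.card_fin, Fintype.card_unit, Fintype.card_prod] at h1 ⊢
    omega
  · exact (h₀ x).trans (measuredProb_congr_pred _ _ _ _ fun b => decide_eq_true_iff)
  · refine ((h₁ x).trans (measuredProb_congr_pred _ _ _ _ fun b => decide_eq_true_iff)).trans ?_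
    exact measuredProb_congr _ _ _ fun b b' _ _ => Prod.mk_inj.trans (record_succ_eq_iff hk).symm

/-- Every number below the number of steps is a step. -/
theorem exists_step_eq {T : ℕ} (hT : T < (Nat.clog 2 N + 1) * s) :
    ∃ (j : Fin s) (k : ℕ), k ≤ Nat.clog 2 N ∧ step N j k = T := by
  refine ⟨⟨T / (Nat.clog 2 N + 1), Nat.div_lt_of_lt_mul hT⟩,
    Nat.clog 2 N - T % (Nat.clog 2 N + 1), Nat.sub_le _ _, ?_⟩
  have h1 : T % (Nat.clog 2 N + 1) < Nat.clog 2 N + 1 := Nat.mod_lt T (Nat.succ_pos _)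
  have h2 := Nat.div_add_mod T (Nat.clog 2 N + 1)
  simp only [step]
  omega

/-- An adversary that runs empty circuits, and has a work qubit to hold its answer. -/
def HashAdversary.trivial (κ n m : ℕ) : HashAdversary κ n m := ⟨1, [], [], .work 0⟩

/-- Some adversary against the hash function does as well as the given adversary against Merkle
trees, up to the number of hybrids: the one for the step with the largest gap. -/
theorem exists_hashAdversary_le (H : HashFamily)
    (hn : ∀ l, H.inLen l = H.outLen l + H.outLen l) {l : ℕ}
    (hev : HasCircuit (fun b : Fin (H.keyLen l) ⊕ Fin (H.inLen l) → Bool =>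
      H.eval l (b ∘ Sum.inl) (b ∘ Sum.inr)) hc)
    (A : VCAdversary (H.keyLen l) (H.outLen l) (H.inLen l) N)
    (hS : SizeBound (H.keyLen l) (H.inLen l) (H.outLen l) N A.slots hc S) (hA : A.size ≤ S) :
    ∃ B : HashAdversary (H.keyLen l) (H.inLen l) (H.outLen l), B.size ≤ 3600 * S ^ 3 ∧
      |(merkle H hn).collapseProb l N A false - (merkle H hn).collapseProb l N A true| ≤
        S * |H.collapseProb l B false - H.collapseProb l B true| := by
  let hyb : ℕ → ℝ := fun T => ∑ k, (H.keyDist l k).toReal * measuredProb A.second A.answer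
    (Accepted (hn l) (H.eval l k)) (record (hn l) (H.eval l k) T) (A.first.run (ket (vcInit k)))
  have h₀ : (merkle H hn).collapseProb l N A false = hyb 0 := by
    rw [collapseProb_merkle_eq_sum]
    simp only [merkleExp_false, hyb]
  have h₁ : (merkle H hn).collapseProb l N A true = hyb ((Nat.clog 2 N + 1) * A.slots) := by
    rw [collapseProb_merkle_eq_sum]
    simp only [merkleExp_true, hyb]
  have hstep : ∀ T < (Nat.clog 2 N + 1) * A.slots,
      ∃ B : HashAdversary (H.keyLen l) (H.inLen l) (H.outLen l), B.size ≤ 3600 * S ^ 3 ∧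
        H.collapseProb l B false = hyb T ∧ H.collapseProb l B true = hyb (T + 1) := by
    intro T hT
    obtain ⟨j, k, hk, rfl⟩ := exists_step_eq hT
    obtain ⟨B, hB, hB₀, hB₁⟩ := exists_hashAdversary_step (hn l) hev A hS hA j hk
    refine ⟨B, hB, ?_, ?_⟩
    · rw [collapseProb_eq_sum_hashExp]
      simp only [hB₀, hyb]
    · rw [collapseProb_eq_sum_hashExp]
      simp only [hB₁, hyb]
  have htel : |hyb 0 - hyb ((Nat.clog 2 N + 1) * A.slots)| ≤
      ∑ T ∈ Finset.range ((Nat.clog 2 N + 1) * A.slots), |hyb T - hyb (T + 1)| := by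
    rw [← Finset.sum_range_sub']
    exact Finset.abs_sum_le_sum_abs _ _
  rw [h₀, h₁]
  rcases Nat.eq_zero_or_pos ((Nat.clog 2 N + 1) * A.slots) with hM | hM
  · -- without slots nothing but the classical message is measured in either experiment
    refine ⟨HashAdversary.trivial _ _ _, ?_, ?_⟩
    · have := hS.one_le
      have := hS.key_le
      have := hS.inp_le
      have := hS.out_le
      have : S ≤ S ^ 3 := Nat.le_self_pow three_ne_zero S
      simp only [HashAdversary.size, HashAdversary.trivial, List.length_nil]
      omega
    · rw [hM, sub_self, abs_zero]
      positivity
  · obtain ⟨T, hT, hmax⟩ := Finset.exists_max_image (Finset.range ((Nat.clog 2 N + 1) * A.slots))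
      (fun T => |hyb T - hyb (T + 1)|) ⟨0, Finset.mem_range.2 hM⟩
    obtain ⟨B, hB, hB₀, hB₁⟩ := hstep T (Finset.mem_range.1 hT)
    refine ⟨B, hB, ?_⟩
    rw [hB₀, hB₁]
    refine htel.trans ((Finset.sum_le_card_nsmul _ _ _ hmax).trans ?_)
    rw [Finset.card_range, nsmul_eq_mul, mul_comm (Nat.clog 2 N + 1)]
    exact mul_le_mul_of_nonneg_right (Nat.cast_le.2 hS.slots_le) (abs_nonneg _)

end Hybrids

/-! ### Asymptotics -/

section Asymptotics

theorem Negligible.poly_mul_le {f g : ℕ → ℝ} {S : ℕ → ℕ} (hS : PolyBounded S)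
    (hg : Negligible g) (hf₀ : ∀ l, 0 ≤ f l) (hg₀ : ∀ l, 0 ≤ g l)
    (hfg : ∀ l, f l ≤ S l * g l) : Negligible f := by
  obtain ⟨p, l₀, hp⟩ := hS
  refine (Asymptotics.SuperpolynomialDecay.polynomial_mul hg
    (p.map (Nat.castRingHom ℝ))).trans_eventually_abs_le ?_
  filter_upwards [Filter.eventually_gt_atTop l₀] with l hl
  rw [Function.comp_apply, abs_of_nonneg (hf₀ l)]
  refine (hfg l).trans (le_trans ?_ (le_abs_self _))
  refine mul_le_mul_of_nonneg_right ?_ (hg₀ l)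
  rw [Polynomial.eval_natCast_map, Nat.coe_castRingHom]
  exact Nat.cast_le.2 (hp l hl)

theorem merkle_collapsing (H : HashFamily) (hn : ∀ l, H.inLen l = H.outLen l + H.outLen l)
    (hEff : H.EfficientlyComputable) (hH : H.Collapsing) : (merkle H hn).Collapsing := by
  intro N A hA
  obtain ⟨work, C, hC, hrun⟩ := hEff
  let S : ℕ → ℕ := fun l => (A l).size +
    ((C l).length + H.keyLen l + H.inLen l + H.outLen l + work l) + 1
  have hbound : ∀ l, SizeBound (H.keyLen l) (H.inLen l) (H.outLen l) (N l) (A l).slots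
      ((C l).length + work l) (S l) := by
    intro l
    have h : (A l).slots * (Nat.clog 2 (N l) + 1) ≤
        (A l).slots * (1 + Nat.clog 2 (N l) + H.inLen l) :=
      Nat.mul_le_mul_left _ (by omega)
    have hA : (A l).slots * (1 + Nat.clog 2 (N l) + H.inLen l) ≤ (A l).size :=
      (Nat.le_add_left _ _).trans ((Nat.le_add_right _ _).trans (Nat.le_add_right _ _))
    constructor <;> simp only [S] <;> omega
  have key := fun l => exists_hashAdversary_le H hn
    (hasCircuit_of_hashInit (C l) (hrun l)) (A l) (hbound l)
    ((Nat.le_add_right _ _).trans (Nat.le_add_right _ _))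
  choose B hB hle using key
  have hS : PolyBounded S := by
    obtain ⟨p, l₀, hp⟩ := hA
    obtain ⟨q, l₁, hq⟩ := hC
    refine ⟨p + q + 1, max l₀ l₁, fun l hl => ?_⟩
    rw [Polynomial.eval_add, Polynomial.eval_add, Polynomial.eval_one]
    exact Nat.add_le_add_right (add_le_add (hp l ((le_max_left _ _).trans_lt hl))
      (hq l ((le_max_right _ _).trans_lt hl))) 1
  have hsize : PolyBounded fun l => (B l).size := by
    obtain ⟨p, l₀, hp⟩ := hS
    refine ⟨3600 * p ^ 3, l₀, fun l hl => (hB l).trans ?_⟩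
    rw [Polynomial.eval_mul, Polynomial.eval_pow, Polynomial.eval_ofNat]
    exact Nat.mul_le_mul_left _ (Nat.pow_le_pow_left (hp l hl) 3)
  exact Negligible.poly_mul_le hS (hH B hsize) (fun _ => abs_nonneg _) (fun _ => abs_nonneg _) hle

end Asymptotics

/-! ### Completeness -/

section Completeness

variable {n m N : ℕ}

/-- The root recomputed from a symbol of the vector and honest siblings is the node of the tree. -/
theorem pathRoot_eq_node (hn : n = m + m) (h : Bits n → Bits m) (msg : Fin N → Bits n) (i : Fin N)
    (d : ℕ) (path : Fin d → Bits m)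
    (hp : ∀ k : Fin d, path k = node hn h msg k ((i.val / 2 ^ k.val) ^^^ 1)) :
    pathRoot hn h i (msg i) d path = node hn h msg d (i.val / 2 ^ d) := by
  induction d with
  | zero => simp [pathRoot, node]
  | succ d ih =>
    rw [pathRoot, ih _ fun k => hp k.castSucc, hp (Fin.last d), node, Fin.val_last, pow_succ,
      ← Nat.div_div_eq_div_mul, Nat.testBit_eq_decide_div_mod_eq]
    generalize i.val / 2 ^ d = q
    rcases Nat.mod_two_eq_zero_or_one q with hq | hq
    · have h1 : 2 * (q / 2) = q := by omega
      have h2 : q ^^^ 1 = q + 1 := by rw [Nat.xor_one_of_even (Nat.even_iff.2 hq)]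
      simp [hq, h1, h2]
    · have h1 : 2 * (q / 2) = q - 1 := by omega
      have h2 : q ^^^ 1 = q - 1 := by rw [Nat.xor_one_of_odd (Nat.odd_iff.2 hq)]
      have h3 : q - 1 + 1 = q := by omega
      simp [hq, h1, h2, h3]

theorem merkle_complete (H : HashFamily) (hn : ∀ l, H.inLen l = H.outLen l + H.outLen l) :
    (merkle H hn).Complete := by
  intro l N Adv
  have key : ∀ ck (mQ : (Fin N → Bits ((merkle H hn).symLen l)) × Finset (Fin N)),
      (((merkle H hn).commit l N ck mQ.1).bind fun ca =>
        PMF.pure ((merkle H hn).verify l N ck ca.1 mQ.2 (fun i => mQ.1 i)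
          ((merkle H hn).openAt l N ck ca.2 mQ.2))) = PMF.pure true := by
    rintro ck ⟨msg, Q⟩
    refine (PMF.pure_bind _ _).trans (congrArg PMF.pure (decide_eq_true fun i => ?_))
    have hroot : i.val.val / 2 ^ Nat.clog 2 N = 0 :=
      Nat.div_eq_of_lt (lt_of_lt_of_le i.val.isLt (Nat.le_pow_clog one_lt_two N))
    have hrank : Q.orderEmbOfFin rfl (rank Q i) = i.val :=
      congrArg Subtype.val ((Q.orderIsoOfFin rfl).apply_symm_apply i)
    refine (pathRoot_eq_node (hn l) (H.eval l ck) msg i.val (Nat.clog 2 N) _ fun k => ?_).trans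
      (by rw [hroot])
    funext r
    simp only [merkle, Equiv.symm_apply_apply, authPath, hrank, Fin.val_castSucc]
  have h : ((merkle H hn).gen l N).bind (fun ck => (Adv ck).bind fun mQ =>
      ((merkle H hn).commit l N ck mQ.1).bind fun ca =>
        PMF.pure ((merkle H hn).verify l N ck ca.1 mQ.2 (fun i => mQ.1 i)
          ((merkle H hn).openAt l N ck ca.2 mQ.2))) = PMF.pure true := by
    simp only [key, PMF.bind_const]
  rw [h, PMF.pure_apply, if_pos rfl]

end Completeness

end MerkleCollapsing

theorem claim5p6 (H : MerkleCollapsing.HashFamily)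
    (hn : ∀ l, H.inLen l = H.outLen l + H.outLen l)
    (hEff : H.EfficientlyComputable) (hH : H.Collapsing) :
    (MerkleCollapsing.merkle H hn).Complete ∧ (MerkleCollapsing.merkle H hn).Collapsing :=
  ⟨MerkleCollapsing.merkle_complete H hn, MerkleCollapsing.merkle_collapsing H hn hEff hH⟩
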